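/- Let $S$ be an (embedded) $k$-dimensional $C^1$ submanifold of $\mathbb{R}^n$ with surface measure $d\sigma$, and let $\pi$ be a $k$-dimensional linear subspace of $\mathbb{R}^n$ with Lebesgue measure $\lambda_\pi$. For $g:S\to\mathbb{C}$ integrable write $$\widehat{gd\sigma}(x)=\int_S g(\xi)e^{-2\pi i x\cdot\xi}\,d\sigma(\xi),\qquad T_{k,n}(|\widehat{gd\sigma}|^2)(\pi,y)=\int_\pi|\widehat{gd\sigma}(x+y)|^2\,d\lambda_\pi(x)\in[0,\infty]\quad(y\in\pi^\perp).$$ Consider the conditions $$\text{(T)}\quad T_\xi S\cap\pi^\perp=\{0\}\ \text{ for all }\xi\in S,\qquad\qquad \text{(GT)}\quad \langle\xi-\eta\rangle\cap\pi^\perp=\{0\}\ \text{ for all }\xi,\eta\in S,$$ and the identity $$\text{(id)}\quad T_{k,n}(|\widehat{gd\sigma}|^2)(\pi,y)=\int_S\frac{|g(\xi)|^2}{|(T_\xi S)^\perp\wedge\pi|}\,d\sigma(\xi),$$ where $|V\wedge W|$ denotes the norm of the wedge product of the vectors of an orthonormal basis of $V$ and an orthonormal basis of $W$, and $a/0=\infty$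 for $a>0$, $0/0=0$. (1) Suppose that (T) holds. If (GT) fails, there are $\xi_0,\eta_0\in S$ with $\xi_0-\eta_0\in\pi^\perp\setminus\{0\}$. For every such pair and every sufficiently small $\varepsilon>0$ the function $g_0=\chi_{C_\varepsilon(\xi_0)}+\chi_{C_\varepsilon(\eta_0)}$, where $C_\varepsilon(a)=\{\xi\in S:|\xi-a|<\varepsilon\}$, is in $L^1\cap L^2(d\sigma)$ with compact support in $S$, and has the following properties. The function $y\mapsto T_{k,n}(|\widehat{g_0d\sigma}|^2)(\pi,y)$ is finite on $\pi^\perp$, and at the points $y=t(\xi_0-\eta_0)$, for all sufficiently small $t>0$, its derivative in the direction $\xi_0-\eta_0$ exists and is nonzero. In particular it is not constant in $y\in\pi^\perp$, and (id) fails for $g=g_0$ at some $y\in\pi^\perp$. (2) Suppose that (T) fails. Then for every $y\in\pi^\perp$ there is $g\in L^1\cap L^2(d\sigma)$ with compact support in $S$ for which both $T_{k,n}(|\widehat{gd\sigma}|^2)(\pi,y)$ and $\int_S|g(\xi)|^2/|(T_\xi S)^\perp\wedge\pi|\,d\sigma(\xi)$ are infinite. (3) Consequently, if (id) holds with finite values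 for all $g\in L^1\cap L^2(d\sigma)$ with compact support in $S$ and all $y\in\pi^\perp$, then (T) and (GT) hold. -/

import Mathlib

open MeasureTheory Filter Topology Module
open scoped ENNReal

noncomputable section

/-- `S` is an (embedded) `k`-dimensional `C¹` submanifold of `ℝⁿ`: near each of its points a `C¹`
diffeomorphism between open subsets of `ℝⁿ` straightens `S` to a `k`-dimensional linear subspace. -/
def IsC1Submanifold {n : ℕ} (k : ℕ) (S : Set (EuclideanSpace ℝ (Fin n))) : Prop :=
  ∀ p ∈ S, ∃ Φ : OpenPartialHomeomorph (EuclideanSpace ℝ (Fin n)) (EuclideanSpace ℝ (Fin n)),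
    p ∈ Φ.source ∧ ContDiffOn ℝ 1 Φ Φ.source ∧ ContDiffOn ℝ 1 Φ.symm Φ.target ∧
    ∃ V : Submodule ℝ (EuclideanSpace ℝ (Fin n)), finrank ℝ V = k ∧
      ∀ x ∈ Φ.source, x ∈ S ↔ Φ x ∈ V

/-- The tangent space `T_ξ S`: the space of velocities at `ξ` of curves in `S` through `ξ`. (For a
submanifold the velocities already form a linear space.) -/
def tangentSpaceAt {n : ℕ} (S : Set (EuclideanSpace ℝ (Fin n))) (ξ : EuclideanSpace ℝ (Fin n)) :
    Submodule ℝ (EuclideanSpace ℝ (Fin n)) :=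
  Submodule.span ℝ {v | ∃ γ : ℝ → EuclideanSpace ℝ (Fin n),
    γ 0 = ξ ∧ (∀ᶠ t in 𝓝 0, γ t ∈ S) ∧ HasDerivAt γ v 0}

/-- Surface measure `dσ` on a `k`-dimensional `S`: the `k`-dimensional Hausdorff measure on `S`,
normalised so as to agree with Lebesgue measure on `k`-dimensional Euclidean spaces. -/
def surfaceMeasure {n : ℕ} (k : ℕ) (S : Set (EuclideanSpace ℝ (Fin n))) :
    Measure (EuclideanSpace ℝ (Fin n)) :=
  (Measure.euclideanHausdorffMeasure k).restrict S

/-- The Fourier extension operator `x ↦ ∫_S g(ξ) exp(-2πi x·ξ) dσ(ξ)`. -/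
def fourierExtension {n : ℕ} (k : ℕ) (S : Set (EuclideanSpace ℝ (Fin n)))
    (g : EuclideanSpace ℝ (Fin n) → ℂ) (x : EuclideanSpace ℝ (Fin n)) : ℂ :=
  ∫ ξ, g ξ * Complex.exp (-2 * Real.pi * Complex.I * (inner ℝ x ξ : ℝ)) ∂(surfaceMeasure k S)

/-- The `k`-plane transform of a nonnegative function: its integral over the plane `π + y` with
respect to Lebesgue measure on `π`, a value in `[0, ∞]`. -/
def planeTransform {n : ℕ} (f : EuclideanSpace ℝ (Fin n) → ℝ≥0∞)
    (π : Submodule ℝ (EuclideanSpace ℝ (Fin n))) (y : EuclideanSpace ℝ (Fin n)) : ℝ≥0∞ :=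
  ∫⁻ x : π, f ((x : EuclideanSpace ℝ (Fin n)) + y) ∂(volume : Measure π)

/-- The tomographic data: the `k`-plane transform of `|\widehat{g dσ}|²` at `(π, y)`. -/
def tomographicData {n : ℕ} (k : ℕ) (S : Set (EuclideanSpace ℝ (Fin n)))
    (g : EuclideanSpace ℝ (Fin n) → ℂ) (π : Submodule ℝ (EuclideanSpace ℝ (Fin n)))
    (y : EuclideanSpace ℝ (Fin n)) : ℝ≥0∞ :=
  planeTransform (fun x => ENNReal.ofReal (‖fourierExtension k S g x‖ ^ 2)) π y

/-- `|v₁ ∧ ⋯ ∧ v_m|`, the square root of the Gram determinant. -/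
def wedgeNorm {n : ℕ} {ι : Type} [Fintype ι] [DecidableEq ι]
    (v : ι → EuclideanSpace ℝ (Fin n)) : ℝ :=
  Real.sqrt (Matrix.gram ℝ v).det

/-- `|V ∧ W|`: the norm of the wedge product of the vectors of an orthonormal basis of `V` followed
by those of an orthonormal basis of `W`. -/
def subspaceWedge {n : ℕ} (V W : Submodule ℝ (EuclideanSpace ℝ (Fin n))) : ℝ :=
  wedgeNorm (Sum.elim
    (fun i : Fin (finrank ℝ V) => (stdOrthonormalBasis ℝ V i : EuclideanSpace ℝ (Fin n)))
    (fun j : Fin (finrank ℝ W) => (stdOrthonormalBasis ℝ W j : EuclideanSpace ℝ (Fin n))))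

/-- `∫_S |g(ξ)|² / |(T_ξ S)^⊥ ∧ π| dσ(ξ)`, a value in `[0, ∞]`, where `a / 0 = ∞` for `a > 0`. -/
def geometricEnergy {n : ℕ} (k : ℕ) (S : Set (EuclideanSpace ℝ (Fin n)))
    (g : EuclideanSpace ℝ (Fin n) → ℂ) (π : Submodule ℝ (EuclideanSpace ℝ (Fin n))) : ℝ≥0∞ :=
  ∫⁻ ξ, ENNReal.ofReal (‖g ξ‖ ^ 2) /
    ENNReal.ofReal (subspaceWedge (tangentSpaceAt S ξ)ᗮ π) ∂(surfaceMeasure k S)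

/-- Condition (T): `T_ξ S ∩ π^⊥ = {0}` for all `ξ ∈ S`. -/
def LocallyTransverse {n : ℕ} (S : Set (EuclideanSpace ℝ (Fin n)))
    (π : Submodule ℝ (EuclideanSpace ℝ (Fin n))) : Prop :=
  ∀ ξ ∈ S, tangentSpaceAt S ξ ⊓ πᗮ = ⊥

/-- Condition (GT): `⟨ξ - η⟩ ∩ π^⊥ = {0}` for all `ξ, η ∈ S`. -/
def GloballyTransverse {n : ℕ} (S : Set (EuclideanSpace ℝ (Fin n)))
    (π : Submodule ℝ (EuclideanSpace ℝ (Fin n))) : Prop :=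
  ∀ ξ ∈ S, ∀ η ∈ S, Submodule.span ℝ {ξ - η} ⊓ πᗮ = ⊥

/-- `g` is a square integrable (and integrable) density on `S` with compact support in `S`. -/
def IsCompactDensity {n : ℕ} (k : ℕ) (S : Set (EuclideanSpace ℝ (Fin n)))
    (g : EuclideanSpace ℝ (Fin n) → ℂ) : Prop :=
  MemLp g 2 (surfaceMeasure k S) ∧ Integrable g (surfaceMeasure k S) ∧
    HasCompactSupport g ∧ tsupport g ⊆ S

/-- The cap `C_ε(a) = S ∩ {ξ : |ξ - a| < ε}`. -/
def cap {n : ℕ} (S : Set (EuclideanSpace ℝ (Fin n))) (ε : ℝ) (a : EuclideanSpace ℝ (Fin n)) :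
    Set (EuclideanSpace ℝ (Fin n)) :=
  S ∩ {ξ | ‖ξ - a‖ < ε}

/-- The sum `χ_{C_ε(ξ₀)} + χ_{C_ε(η₀)}` of the indicator functions of two caps. -/
def twoCaps {n : ℕ} (S : Set (EuclideanSpace ℝ (Fin n))) (ε : ℝ)
    (ξ₀ η₀ : EuclideanSpace ℝ (Fin n)) : EuclideanSpace ℝ (Fin n) → ℂ :=
  fun ξ => (cap S ε ξ₀).indicator (fun _ => (1 : ℂ)) ξ + (cap S ε η₀).indicator (fun _ => (1 : ℂ)) ξ

end

/-!
Write `P` for the orthogonal projection onto `π`. For `x ∈ π` one has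
`(x + y) · ξ = x · Pξ + y · ξ`, so the function `x ↦ \widehat{g dσ}(x + y)` on `π` is the Fourier
transform of the push-forward under `P` of the measure `exp(-2πi y · ξ) g(ξ) dσ(ξ)`. By Plancherel
the data at `(π, y)` are the squared `L²` norm of this push-forward. Neither half of the argument
computes the surface measure through an area formula: that Lipschitz maps distort Hausdorff
measure in a controlled way is enough.

*When (T) holds.* Near each of its points `S` is the image of an open subset of `π` under a
Lipschitz section of `P` (`LocalParam.exists_lipschitz_section`, from the inverse function theorem).
Hence the surface measure on a small cap is pushed forward to a bounded density, positive almost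
everywhere on the projection of the cap (`exists_isGraphDensity`). For two caps over the same point
of `π`, with densities `J₁`, `J₂` and sections `s₁`, `s₂`, the data are
`∫ (J₁² + J₂²) + 2 ∫ J₁ J₂ cos(2π y · (s₁ - s₂))` (`tomographicData_twoCaps`). On the common support
`s₁ - s₂` is close to `v = ξ₀ - η₀`. Along `y = t v` one may therefore differentiate under the
integral sign, and for small `t > 0` the integrand of the derivative has a strict sign
(`eventually_exists_hasDerivAt_integral_cos`).

*When (T) fails at `p`.* The projection read in a chart has a derivative at `p` of determinant zero,
so small pieces `C` of `S` around `p` satisfy `vol (P C) ≤ δ σ(C)`, with `δ` arbitrarily small,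
while the factor `|(T_ξ S)ᗮ ∧ π|` is at most `δ` on `C` (`LocalParam.exists_small_projection`). A
square integrable density which is large on a sequence of such pieces with `δ = 4⁻ʲ`
(`exists_density_of_pieces`) has infinite energy. Its data are infinite as well: a finite measure
`ν` on `π` whose Fourier transform is square integrable obeys `ν(K)² ≤ vol(K) ‖ν̂‖²` on compact sets
(`measure_sq_le_mul_lintegral_norm_sq`), which the projected pieces violate. Multiplying the density
by `exp(2πi y · ξ)` moves the construction to any given `y`.
-/

/-! ### Plancherel for integrable functions and a converse for measures -/

section Fourier

open FourierTransform SchwartzMap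
open scoped ContDiff RealInnerProductSpace

/-- A smooth bump function which is `1` on the compact set `K` and vanishes off the open set `O`. -/
theorem exists_contDiff_one_on_compact {E : Type*} [NormedAddCommGroup E]
    [InnerProductSpace ℝ E] [FiniteDimensional ℝ E] {K O : Set E} (hK : IsCompact K) (hO : IsOpen O)
    (hKO : K ⊆ O) : ∃ f : E → ℝ, ContDiff ℝ ∞ f ∧ HasCompactSupport f ∧ (∀ x ∈ K, f x = 1) ∧
      (∀ x ∉ O, f x = 0) ∧ ∀ x, f x ∈ Set.Icc (0 : ℝ) 1 := by
  obtain ⟨K', hK', hKK', hK'O⟩ := exists_compact_between hK hO hKO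
  obtain ⟨f, hf0, hf1, hf⟩ := exists_contMDiffMap_zero_one_of_isClosed (n := (⊤ : ℕ∞))
    (modelWithCornersSelf ℝ E) (isOpen_interior.isClosed_compl (s := interior K')) hK.isClosed
    (Set.disjoint_compl_left_iff_subset.2 hKK')
  refine ⟨f, by exact f.contMDiff.contDiff, HasCompactSupport.intro hK' fun x hx => ?_,
    fun x hx => hf1 hx, fun x hx => ?_, hf⟩
  · exact hf0 fun h => hx (interior_subset h)
  · exact hf0 fun h => hx (hK'O (interior_subset h))

variable {E : Type*} [NormedAddCommGroup E] [InnerProductSpace ℝ E] [FiniteDimensional ℝ E]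
  [MeasurableSpace E] [BorelSpace E]

theorem fourier_fun_add {F G : E → ℂ} (hF : Integrable F) (hG : Integrable G) (x : E) :
    𝓕 (fun u => F u + G u) x = 𝓕 F x + 𝓕 G x :=
  congrFun (VectorFourier.fourierIntegral_add (L := innerₗ E)
    Real.continuous_fourierChar continuous_inner hF hG) x

/-- For integrable and square integrable functions the Fourier integral agrees with the `L²` Fourier
transform: both have the same pairing with test functions. -/
theorem fourier_ae_eq_fourier_toLp {F : E → ℂ} (h1 : Integrable F) (h2 : MemLp F 2) :
    𝓕 F =ᵐ[volume] (𝓕 (h2.toLp F) : Lp ℂ 2 (volume : Measure E)) := by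
  apply ae_eq_of_integral_contDiff_smul_eq
  · have hc : Continuous (𝓕 F) := VectorFourier.fourierIntegral_continuous
      Real.continuous_fourierChar (L := innerₗ E) continuous_inner h1
    exact hc.locallyIntegrable
  · exact (Lp.memLp _).locallyIntegrable (by norm_num)
  intro g hg hgc
  have hg' : ContDiff ℝ ∞ (fun x => (g x : ℂ)) := Complex.ofRealCLM.contDiff.comp hg
  have hgc' : HasCompactSupport (fun x => (g x : ℂ)) := hgc.comp_left (g := ((↑) : ℝ → ℂ)) (by simp)
  have key := congrArg (fun T => T (hgc'.toSchwartzMap hg'))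
    (Lp.fourier_toTemperedDistribution_eq (h2.toLp F))
  simp only [TemperedDistribution.fourier_apply, Lp.toTemperedDistribution_apply] at key
  have e1 : ∫ x, g x • (𝓕 (h2.toLp F) : Lp ℂ 2 (volume : Measure E)) x =
      ∫ x, (hgc'.toSchwartzMap hg') x • (𝓕 (h2.toLp F) : Lp ℂ 2 (volume : Measure E)) x := by
    simp
  rw [e1, ← key]
  have e2 : ∫ x, (𝓕 (hgc'.toSchwartzMap hg')) x • (h2.toLp F) x =
      ∫ x, (𝓕 (fun x => (g x : ℂ))) x • F x := by
    apply integral_congr_ae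
    filter_upwards [h2.coeFn_toLp] with x hx
    rw [hx]; rfl
  rw [e2]
  have := VectorFourier.integral_fourierIntegral_smul_eq_flip (L := innerₗ E)
    (μ := (volume : Measure E)) (ν := (volume : Measure E))
    Real.continuous_fourierChar continuous_inner
    (f := fun x => (g x : ℂ)) (g := F) (hg'.continuous.integrable_of_hasCompactSupport hgc') h1
  rw [flip_innerₗ] at this
  simpa using! this.symm

theorem ofReal_norm_sq_eq_enorm_rpow (z : ℂ) : ENNReal.ofReal (‖z‖ ^ 2) = ‖z‖ₑ ^ (2 : ℝ) := by
  rw [ENNReal.ofReal_pow (norm_nonneg _), ofReal_norm]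
  norm_cast

theorem lintegral_ofReal_norm_sq {α : Type*} [MeasurableSpace α] (μ : Measure α) (F : α → ℂ) :
    ∫⁻ x, ENNReal.ofReal (‖F x‖ ^ 2) ∂μ = eLpNorm F 2 μ ^ 2 := by
  simp only [ofReal_norm_sq_eq_enorm_rpow]
  rw [eLpNorm_eq_lintegral_rpow_enorm_toReal (by norm_num) (by norm_num)]
  rw [← ENNReal.rpow_natCast, ← ENNReal.rpow_mul]
  simp

/-- Plancherel's theorem for the Fourier integral on `L¹ ∩ L²`. -/
theorem lintegral_norm_sq_fourier {F : E → ℂ} (h1 : Integrable F) (h2 : MemLp F 2) :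
    ∫⁻ x, ENNReal.ofReal (‖𝓕 F x‖ ^ 2) = ∫⁻ x, ENNReal.ofReal (‖F x‖ ^ 2) := by
  rw [lintegral_ofReal_norm_sq, lintegral_ofReal_norm_sq,
    eLpNorm_congr_ae (fourier_ae_eq_fourier_toLp h1 h2)]
  have := Lp.norm_fourier_eq (h2.toLp F)
  rw [Lp.norm_def, Lp.norm_toLp] at this
  rw [(ENNReal.toReal_eq_toReal_iff' (Lp.eLpNorm_ne_top _) h2.eLpNorm_ne_top).1 this]

/-- Parseval's identity and Cauchy-Schwarz: a finite measure with Fourier transform in `L²` acts on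
Schwartz functions as a functional bounded in the `L²` norm. -/
theorem enorm_integral_schwartz_le (ν : Measure E) [IsFiniteMeasure ν] (ψ : 𝓢(E, ℂ)) :
    ‖∫ u, ψ u ∂ν‖ₑ ≤ eLpNorm (fun x => ∫ u, 𝐞 (-⟪u, x⟫) • (1 : ℂ) ∂ν) 2 volume *
      eLpNorm ψ 2 volume := by
  set h : 𝓢(E, ℂ) := 𝓕⁻ ψ with hh
  have hψ : 𝓕 h = ψ := by simp [hh]
  have := VectorFourier.integral_fourierIntegral_smul_eq_flip (L := innerₗ E)
    (μ := ν) (ν := (volume : Measure E))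
    Real.continuous_fourierChar continuous_inner
    (f := fun x => (1 : ℂ)) (g := h) (integrable_const _) h.integrable
  rw [flip_innerₗ] at this
  have e : ∫ u, ψ u ∂ν = ∫ x, (∫ u, 𝐞 (-⟪u, x⟫) • (1 : ℂ) ∂ν) * h x := by
    rw [← hψ]
    simpa [VectorFourier.fourierIntegral] using! this.symm
  rw [e]
  have hn : eLpNorm h 2 volume = eLpNorm ψ 2 volume := by
    have h1 := lintegral_norm_sq_fourier h.integrable (h.memLp 2)
    rw [lintegral_ofReal_norm_sq, lintegral_ofReal_norm_sq, ← SchwartzMap.fourier_coe, hψ] at h1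
    exact ((ENNReal.pow_right_strictMono two_ne_zero).injective h1).symm
  rw [← hn]
  have hc : Continuous (fun x => ∫ u, 𝐞 (-⟪u, x⟫) • (1 : ℂ) ∂ν) :=
    VectorFourier.fourierIntegral_continuous (μ := ν)
      Real.continuous_fourierChar (L := innerₗ E) continuous_inner (integrable_const (1 : ℂ))
  have := eLpNorm_smul_le_mul_eLpNorm (p := 2) (q := 2) (r := 1) (μ := (volume : Measure E))
    h.continuous.aestronglyMeasurable hc.aestronglyMeasurable
  refine le_trans ?_ this
  refine (enorm_integral_le_lintegral_enorm _).trans ?_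
  rw [eLpNorm_one_eq_lintegral_enorm]
  rfl

/-- A finite measure whose Fourier transform is square integrable cannot concentrate on small
compact sets. Finiteness is needed: for a point mass and `K` the point, the right-hand side is
`0 * ∞ = 0`. -/
theorem measure_sq_le_mul_lintegral_norm_sq (ν : Measure E) [IsFiniteMeasure ν] {K : Set E}
    (hK : IsCompact K)
    (hν : ∫⁻ x, ENNReal.ofReal (‖∫ u, 𝐞 (-⟪u, x⟫) • (1 : ℂ) ∂ν‖ ^ 2) ≠ ⊤) :
    ν K ^ 2 ≤ volume K * ∫⁻ x, ENNReal.ofReal (‖∫ u, 𝐞 (-⟪u, x⟫) • (1 : ℂ) ∂ν‖ ^ 2) := by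
  set I := ∫⁻ x, ENNReal.ofReal (‖∫ u, 𝐞 (-⟪u, x⟫) • (1 : ℂ) ∂ν‖ ^ 2) with hI
  have main : ∀ O : Set E, IsOpen O → K ⊆ O → ν K ^ 2 ≤ volume O * I := by
    intro O hO hKO
    obtain ⟨f, hf, hfc, h1, h0, h01⟩ := exists_contDiff_one_on_compact hK hO hKO
    have hf' : ContDiff ℝ ∞ (fun x => (f x : ℂ)) := Complex.ofRealCLM.contDiff.comp hf
    have hfc' : HasCompactSupport (fun x => (f x : ℂ)) :=
      hfc.comp_left (g := ((↑) : ℝ → ℂ)) (by simp)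
    have key := enorm_integral_schwartz_le ν (hfc'.toSchwartzMap hf')
    have hint : Integrable f ν := Integrable.of_bound hf.continuous.aestronglyMeasurable 1
      (ae_of_all _ fun x => by rw [Real.norm_of_nonneg (h01 x).1]; exact (h01 x).2)
    have e1 : ν K ≤ ‖∫ u, (hfc'.toSchwartzMap hf') u ∂ν‖ₑ := by
      have : ∫ u, (hfc'.toSchwartzMap hf') u ∂ν = ((∫ u, f u ∂ν : ℝ) : ℂ) := by
        simp only [HasCompactSupport.toSchwartzMap_toFun]
        exact integral_ofReal
      rw [this, ← ofReal_norm, Complex.norm_real,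
        Real.norm_of_nonneg (integral_nonneg fun x => (h01 x).1),
        ofReal_integral_eq_lintegral_ofReal hint (ae_of_all _ fun x => (h01 x).1),
        ← lintegral_indicator_one hK.measurableSet]
      refine lintegral_mono fun x => ?_
      by_cases hx : x ∈ K
      · simp [hx, h1 x hx]
      · simp [hx]
    have e2 : eLpNorm (hfc'.toSchwartzMap hf') 2 volume ^ 2 ≤ volume O := by
      rw [← lintegral_ofReal_norm_sq, ← lintegral_indicator_one hO.measurableSet]
      refine lintegral_mono fun x => ?_
      by_cases hx : x ∈ O
      · simp only [HasCompactSupport.toSchwartzMap_toFun, Complex.norm_real, hx,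
          Set.indicator_of_mem, Pi.one_apply, ENNReal.ofReal_le_one]
        rw [Real.norm_of_nonneg (h01 x).1]
        exact pow_le_one₀ (h01 x).1 (h01 x).2
      · simp [hx, h0 x hx]
    calc ν K ^ 2 ≤ (eLpNorm (fun x => ∫ u, 𝐞 (-⟪u, x⟫) • (1 : ℂ) ∂ν) 2 volume *
          eLpNorm (hfc'.toSchwartzMap hf') 2 volume) ^ 2 := by gcongr; exact e1.trans key
      _ = I * eLpNorm (hfc'.toSchwartzMap hf') 2 volume ^ 2 := by
        rw [mul_pow, hI, lintegral_ofReal_norm_sq]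
      _ ≤ _ := by rw [mul_comm]; gcongr
  -- Outer regularity: shrink `O` to `K`.
  have hlim : Tendsto (fun ε : ℝ≥0∞ => (volume K + ε) * I) (𝓝[>] 0) (𝓝 ((volume K + 0) * I)) :=
    (ENNReal.Tendsto.mul_const (tendsto_const_nhds.add tendsto_id) (Or.inr hν)).mono_left
      nhdsWithin_le_nhds
  rw [add_zero] at hlim
  refine ge_of_tendsto hlim ?_
  filter_upwards [self_mem_nhdsWithin] with ε hε
  obtain ⟨O, hKO, hO, hlt⟩ := K.exists_isOpen_lt_add (μ := volume) hK.measure_lt_top.ne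
    (ne_of_gt hε)
  exact (main O hO hKO).trans (by gcongr)

end Fourier

/-! ### Wedge norms, Hausdorff measure and local parametrizations -/

section Geometry

open scoped NNReal RealInnerProductSpace

theorem LipschitzOnWith.euclideanHausdorffMeasure_image_le {X Y : Type*} [EMetricSpace X]
    [MeasurableSpace X] [BorelSpace X] [EMetricSpace Y] [MeasurableSpace Y] [BorelSpace Y]
    {K : ℝ≥0} {f : X → Y} {s : Set X} (h : LipschitzOnWith K f s) (d : ℕ) :
    Measure.euclideanHausdorffMeasure d (f '' s) ≤
      (K : ℝ≥0∞) ^ d * Measure.euclideanHausdorffMeasure d s := by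
  simp only [Measure.euclideanHausdorffMeasure_def, Measure.smul_apply, ENNReal.smul_def,
    smul_eq_mul]
  have := h.hausdorffMeasure_image_le (d := d) (by positivity)
  rw [ENNReal.rpow_natCast] at this
  calc _ ≤ _ * ((K : ℝ≥0∞) ^ d * Measure.hausdorffMeasure (d : ℝ) s) := by gcongr
    _ = _ := by ring

/-- A matrix with entries at most `1` which maps a vector `c` to a small vector has small
determinant, since `det A • c` is the adjugate of `A` applied to `A c`. -/
theorem Matrix.abs_det_mul_le {ι : Type*} [Fintype ι] [DecidableEq ι] (A : Matrix ι ι ℝ)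
    (hA : ∀ i j, |A i j| ≤ 1) (c : ι → ℝ) {η : ℝ} (hη : ∀ i, |(A.mulVec c) i| ≤ η) (i : ι) :
    |A.det| * |c i| ≤ Fintype.card ι * ((Fintype.card ι).factorial * η) := by
  have hadj : ∀ i j, |A.adjugate i j| ≤ (Fintype.card ι).factorial := by
    intro i j
    rw [Matrix.adjugate_apply]
    have := Matrix.det_le (A := A.updateRow j (Pi.single i 1)) (abv := AbsoluteValue.abs) (x := 1)
      (fun a b => by
        rw [Matrix.updateRow_apply]
        split_ifs
        · by_cases h : b = i
          · subst h; simp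
          · simp [Pi.single_eq_of_ne h]
        · exact hA a b)
    simpa using this
  have e : A.det * c i = ∑ j, A.adjugate i j * (A.mulVec c) j := by
    have : (A.adjugate.mulVec (A.mulVec c)) i = A.det * c i := by
      rw [Matrix.mulVec_mulVec, Matrix.adjugate_mul, Matrix.smul_mulVec, Matrix.one_mulVec]
      simp
    rw [← this]; rfl
  rw [← abs_mul, e]
  calc _ ≤ ∑ j, |A.adjugate i j * (A.mulVec c) j| := Finset.abs_sum_le_sum_abs _ _
    _ ≤ ∑ j : ι, ((Fintype.card ι).factorial * η) := by
      refine Finset.sum_le_sum fun j _ => ?_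
      rw [abs_mul]
      exact mul_le_mul (hadj i j) (hη j) (abs_nonneg _) (by positivity)
    _ = _ := by simp

/-- If a vector is almost orthogonal to all of `n` vectors in the unit ball, their wedge product is
small. -/
theorem wedgeNorm_mul_norm_le {n : ℕ} {ι : Type} [Fintype ι] [DecidableEq ι]
    (u : ι → EuclideanSpace ℝ (Fin n)) (hu : ∀ i, ‖u i‖ ≤ 1) (e : ι ≃ Fin n)
    (v : EuclideanSpace ℝ (Fin n)) {η : ℝ} (hη : ∀ i, |⟪u i, v⟫| ≤ η) :
    wedgeNorm u * ‖v‖ ≤ n * (n * (n.factorial * η)) := by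
  set B : Matrix ι ι ℝ := Matrix.of fun i j => u i (e j) with hB
  have hgram : Matrix.gram ℝ u = B * B.transpose := by
    ext i j
    simp only [Matrix.gram_apply, Matrix.mul_apply, hB, Matrix.of_apply, Matrix.transpose_apply,
      PiLp.inner_apply]
    rw [← e.sum_comp]
    refine Finset.sum_congr rfl fun x _ => ?_
    simp [mul_comm]
  have hw : wedgeNorm u = |B.det| := by
    rw [wedgeNorm, hgram, Matrix.det_mul, Matrix.det_transpose, Real.sqrt_mul_self_eq_abs]
  have hcard : Fintype.card ι = n := by rw [Fintype.card_congr e, Fintype.card_fin]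
  have hmul : ∀ i, (B.mulVec fun j => v (e j)) i = ⟪u i, v⟫ := by
    intro i
    simp only [Matrix.mulVec, dotProduct, hB, Matrix.of_apply, PiLp.inner_apply]
    rw [← e.sum_comp]
    refine Finset.sum_congr rfl fun x _ => ?_
    simp [mul_comm]
  have hcoord := Matrix.abs_det_mul_le B
    (fun i j => (PiLp.norm_apply_le (u i) (e j)).trans (hu i))
    (fun j => v (e j)) (η := η) (fun i => by rw [hmul]; exact hη i)
  rw [hcard] at hcoord
  have hv : ‖v‖ ≤ ∑ i : Fin n, |v i| := by
    rw [EuclideanSpace.norm_eq]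
    refine Real.sqrt_le_iff.2 ⟨Finset.sum_nonneg fun i _ => abs_nonneg _, ?_⟩
    simpa using Finset.sum_sq_le_sq_sum_of_nonneg (s := Finset.univ) (f := fun i => |v i|)
      (fun i _ => abs_nonneg _)
  rw [hw]
  calc |B.det| * ‖v‖ ≤ |B.det| * ∑ i : Fin n, |v i| := by gcongr
    _ = ∑ i : Fin n, |B.det| * |v i| := Finset.mul_sum _ _ _
    _ ≤ ∑ i : Fin n, (n * (n.factorial * η)) := Finset.sum_le_sum fun i _ => by
        simpa using hcoord (e.symm i)
    _ = _ := by simp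

/-- The wedge norm `|Tᗮ ∧ π|` is controlled by how close some vector of `T` is to being orthogonal
to `π`. -/
theorem subspaceWedge_orthogonal_mul_norm_le {n : ℕ} (T π : Submodule ℝ (EuclideanSpace ℝ (Fin n)))
    (h : finrank ℝ T = finrank ℝ π) {v : EuclideanSpace ℝ (Fin n)} (hv : v ∈ T) :
    subspaceWedge Tᗮ π * ‖v‖ ≤ n * (n * (n.factorial * ‖π.orthogonalProjectionOnto v‖)) := by
  have hdim : finrank ℝ Tᗮ + finrank ℝ π = n := by
    have := T.finrank_add_finrank_orthogonal
    rw [finrank_euclideanSpace_fin] at this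
    omega
  refine wedgeNorm_mul_norm_le _ ?_ (finSumFinEquiv.trans (finCongr hdim)) v ?_
  · rintro (i | j)
    · simp only [Sum.elim_inl]
      exact ((stdOrthonormalBasis ℝ Tᗮ).orthonormal.1 i).le
    · simp only [Sum.elim_inr]
      exact ((stdOrthonormalBasis ℝ π).orthonormal.1 j).le
  · rintro (i | j)
    · simp only [Sum.elim_inl]
      rw [real_inner_comm, (Submodule.mem_orthogonal _ _).1 (stdOrthonormalBasis ℝ Tᗮ i).2 v hv]
      simp
    · simp only [Sum.elim_inr]
      rw [← Submodule.inner_orthogonalProjectionOnto_eq_of_mem_left]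
      refine (abs_real_inner_le_norm _ _).trans ?_
      rw [(stdOrthonormalBasis ℝ π).orthonormal.1 j, one_mul]

/-- A local `C¹` parametrization of `S` by the open subset `dom` of a normed space `V`: the map
`toFun` is a bijection from `dom` onto the part of `S` in the open set `nhd`, and its inverse is the
restriction of the `C¹` map `inv`, defined on all of `nhd`. The last field says that `S` is
relatively closed in `nhd`. -/
structure LocalParam {n : ℕ} (S : Set (EuclideanSpace ℝ (Fin n))) (V : Type*)
    [NormedAddCommGroup V] [NormedSpace ℝ V] where
  toFun : V → EuclideanSpace ℝ (Fin n)
  inv : EuclideanSpace ℝ (Fin n) → V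
  dom : Set V
  nhd : Set (EuclideanSpace ℝ (Fin n))
  isOpen_dom : IsOpen dom
  isOpen_nhd : IsOpen nhd
  contDiffOn : ContDiffOn ℝ 1 toFun dom
  contDiffOn_inv : ContDiffOn ℝ 1 inv nhd
  toFun_mem : ∀ a ∈ dom, toFun a ∈ S ∩ nhd
  inv_toFun : ∀ a ∈ dom, inv (toFun a) = a
  inv_mem : ∀ x ∈ S ∩ nhd, inv x ∈ dom
  toFun_inv : ∀ x ∈ S ∩ nhd, toFun (inv x) = x
  isCompact_inter : ∀ K ⊆ nhd, IsCompact K → IsCompact (S ∩ K)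

theorem IsC1Submanifold.exists_localParam {n k : ℕ} {S : Set (EuclideanSpace ℝ (Fin n))}
    (hS : IsC1Submanifold k S) {p : EuclideanSpace ℝ (Fin n)} (hp : p ∈ S) :
    ∃ V : Submodule ℝ (EuclideanSpace ℝ (Fin n)), finrank ℝ V = k ∧
      ∃ φ : LocalParam S V, p ∈ φ.nhd := by
  obtain ⟨Φ, hpΦ, hΦ, hΦs, V, hV, hSV⟩ := hS p hp
  refine ⟨V, hV, ⟨fun a => Φ.symm a, fun x => V.orthogonalProjectionOnto (Φ x),
    (fun a : V => (a : EuclideanSpace ℝ (Fin n))) ⁻¹' Φ.target, Φ.source,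
    Φ.open_target.preimage continuous_subtype_val, Φ.open_source, ?_, ?_, ?_, ?_, ?_, ?_, ?_⟩, hpΦ⟩
  · exact hΦs.comp (V.subtypeL.contDiff.contDiffOn) fun a ha => ha
  · exact V.orthogonalProjectionOnto.contDiff.comp_contDiffOn hΦ
  · intro a ha
    refine ⟨?_, Φ.map_target ha⟩
    rw [hSV _ (Φ.map_target ha), Φ.right_inv ha]
    exact a.2
  · intro a ha
    change V.orthogonalProjectionOnto (Φ (Φ.symm a)) = a
    rw [Φ.right_inv ha]
    exact V.orthogonalProjectionOnto_mem_subspace_eq_self a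
  · rintro x ⟨hx, hx'⟩
    have : Φ x ∈ V := (hSV x hx').1 hx
    have e : ((V.orthogonalProjectionOnto (Φ x) : V) : EuclideanSpace ℝ (Fin n)) = Φ x :=
      Submodule.starProjection_eq_self_iff.2 this
    simp only [Set.mem_preimage, e]
    exact Φ.map_source hx'
  · rintro x ⟨hx, hx'⟩
    have : Φ x ∈ V := (hSV x hx').1 hx
    have e : ((V.orthogonalProjectionOnto (Φ x) : V) : EuclideanSpace ℝ (Fin n)) = Φ x :=
      Submodule.starProjection_eq_self_iff.2 this
    simp only [e]
    exact Φ.left_inv hx'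
  · intro K hK hKc
    have h1 : IsClosed (K ∩ Φ ⁻¹' (V : Set (EuclideanSpace ℝ (Fin n)))) :=
      (Φ.continuousOn.mono hK).preimage_isClosed_of_isClosed hKc.isClosed
        (Submodule.closed_of_finiteDimensional V)
    have : S ∩ K = K ∩ Φ ⁻¹' (V : Set (EuclideanSpace ℝ (Fin n))) := by
      ext x
      constructor
      · rintro ⟨hx, hxK⟩
        exact ⟨hxK, (hSV x (hK hxK)).1 hx⟩
      · rintro ⟨hxK, hx⟩
        exact ⟨(hSV x (hK hxK)).2 hx, hxK⟩
    rw [this]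
    exact hKc.of_isClosed_subset h1 Set.inter_subset_left

namespace LocalParam

variable {n : ℕ} {S : Set (EuclideanSpace ℝ (Fin n))} {V : Type*}
    [NormedAddCommGroup V] [NormedSpace ℝ V] (φ : LocalParam S V)

theorem contDiffAt {a : V} (ha : a ∈ φ.dom) : ContDiffAt ℝ 1 φ.toFun a :=
  φ.contDiffOn.contDiffAt (φ.isOpen_dom.mem_nhds ha)

theorem contDiffAt_inv {x : EuclideanSpace ℝ (Fin n)} (hx : x ∈ φ.nhd) : ContDiffAt ℝ 1 φ.inv x :=
  φ.contDiffOn_inv.contDiffAt (φ.isOpen_nhd.mem_nhds hx)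

theorem hasFDerivAt {a : V} (ha : a ∈ φ.dom) :
    HasFDerivAt φ.toFun (fderiv ℝ φ.toFun a) a :=
  ((φ.contDiffAt ha).differentiableAt (by norm_num)).hasFDerivAt

theorem hasFDerivAt_inv {x : EuclideanSpace ℝ (Fin n)} (hx : x ∈ φ.nhd) :
    HasFDerivAt φ.inv (fderiv ℝ φ.inv x) x :=
  ((φ.contDiffAt_inv hx).differentiableAt (by norm_num)).hasFDerivAt

theorem injective_fderiv {a : V} (ha : a ∈ φ.dom) : Function.Injective (fderiv ℝ φ.toFun a) := by
  have h1 : HasFDerivAt (φ.inv ∘ φ.toFun)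
      ((fderiv ℝ φ.inv (φ.toFun a)).comp (fderiv ℝ φ.toFun a)) a :=
    (φ.hasFDerivAt_inv (φ.toFun_mem a ha).2).comp a (φ.hasFDerivAt ha)
  have h2 : HasFDerivAt (φ.inv ∘ φ.toFun) (ContinuousLinearMap.id ℝ V) a :=
    (hasFDerivAt_id a).congr_of_eventuallyEq
      (eventually_of_mem (φ.isOpen_dom.mem_nhds ha) fun b hb => φ.inv_toFun b hb)
  have h3 := h1.unique h2
  intro v w hvw
  have := congrArg (fun L => L v) h3
  have h' := congrArg (fun L => L w) h3
  simp only [ContinuousLinearMap.comp_apply, ContinuousLinearMap.id_apply] at this h'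
  rw [← this, hvw, h']

theorem tangentSpaceAt_eq {a : V} (ha : a ∈ φ.dom) :
    tangentSpaceAt S (φ.toFun a) = LinearMap.range (fderiv ℝ φ.toFun a).toLinearMap := by
  apply le_antisymm
  · refine Submodule.span_le.2 ?_
    rintro v ⟨γ, h0, hγ, hv⟩
    have hx := (φ.toFun_mem a ha).2
    rw [← h0] at hx
    have hinv : HasDerivAt (φ.inv ∘ γ) (fderiv ℝ φ.inv (γ 0) v) 0 :=
      (φ.hasFDerivAt_inv hx).comp_hasDerivAt 0 hv
    have hb : (φ.inv ∘ γ) 0 = a := by simp [h0, φ.inv_toFun a ha]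
    have hF : HasFDerivAt φ.toFun (fderiv ℝ φ.toFun a) ((φ.inv ∘ γ) 0) := by
      rw [hb]; exact φ.hasFDerivAt ha
    have h1 := hF.comp_hasDerivAt 0 hinv
    have h2 : HasDerivAt (φ.toFun ∘ φ.inv ∘ γ) v 0 := by
      refine hv.congr_of_eventuallyEq ?_
      filter_upwards [hγ, hv.continuousAt (φ.isOpen_nhd.mem_nhds hx)] with t ht ht'
      exact φ.toFun_inv _ ⟨ht, ht'⟩
    exact ⟨_, h1.unique h2⟩
  · rintro _ ⟨w, rfl⟩
    refine Submodule.subset_span ⟨fun t => φ.toFun (a + t • w), by simp, ?_, ?_⟩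
    · have hc : ContinuousAt (fun t : ℝ => a + t • w) 0 := by fun_prop
      have : φ.dom ∈ 𝓝 (a + (0 : ℝ) • w) := by simpa using φ.isOpen_dom.mem_nhds ha
      filter_upwards [hc this] with t ht
      exact (φ.toFun_mem _ ht).1
    · have h1 : HasDerivAt (fun t : ℝ => a + t • w) w 0 := by
        simpa using ((hasDerivAt_id (0 : ℝ)).smul_const w).const_add a
      have hF : HasFDerivAt φ.toFun (fderiv ℝ φ.toFun a) (a + (0 : ℝ) • w) := by
        simpa using φ.hasFDerivAt ha
      exact hF.comp_hasDerivAt 0 h1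

theorem finrank_tangentSpaceAt [FiniteDimensional ℝ V] {a : V} (ha : a ∈ φ.dom) :
    finrank ℝ (tangentSpaceAt S (φ.toFun a)) = finrank ℝ V := by
  rw [φ.tangentSpaceAt_eq ha]
  exact LinearMap.finrank_range_of_inj (φ.injective_fderiv ha)

end LocalParam

end Geometry

/-! ### Degenerate tangent spaces: small projections and concentrated densities -/

section Degenerate

open scoped NNReal RealInnerProductSpace

namespace LocalParam

variable {n : ℕ} {S : Set (EuclideanSpace ℝ (Fin n))} {V : Type*}
    [NormedAddCommGroup V] [InnerProductSpace ℝ V] [FiniteDimensional ℝ V] (φ : LocalParam S V)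

/-- If the tangent space at a point meets `πᗮ`, then `|(T_ξ S)ᗮ ∧ π|` tends to zero at that point: a
tangent vector orthogonal to `π` is moved continuously to tangent vectors at nearby points. -/
theorem eventually_subspaceWedge_le {π : Submodule ℝ (EuclideanSpace ℝ (Fin n))}
    (hπ : finrank ℝ π = finrank ℝ V) {a : V} (ha : a ∈ φ.dom)
    (hT : tangentSpaceAt S (φ.toFun a) ⊓ πᗮ ≠ ⊥) {δ : ℝ} (hδ : 0 < δ) :
    ∀ᶠ b in 𝓝 a, subspaceWedge (tangentSpaceAt S (φ.toFun b))ᗮ π ≤ δ := by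
  obtain ⟨v, ⟨hvT, hvπ⟩, hv0⟩ := (Submodule.ne_bot_iff _).1 hT
  rw [SetLike.mem_coe, φ.tangentSpaceAt_eq ha] at hvT
  obtain ⟨w, rfl⟩ := hvT
  have hcont : ContinuousAt (fun b => fderiv ℝ φ.toFun b w) a :=
    ((φ.contDiffOn.continuousOn_fderiv_of_isOpen φ.isOpen_dom le_rfl).continuousAt
      (φ.isOpen_dom.mem_nhds ha)).clm_apply continuousAt_const
  have h1 : ContinuousAt (fun b => δ * ‖fderiv ℝ φ.toFun b w‖ - n * (n * (n.factorial *
      ‖π.orthogonalProjectionOnto (fderiv ℝ φ.toFun b w)‖))) a := by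
    have := π.orthogonalProjectionOnto.continuous.continuousAt.comp hcont
    exact (continuousAt_const.mul hcont.norm).sub (continuousAt_const.mul
      (continuousAt_const.mul (continuousAt_const.mul this.norm)))
  have hpos : 0 < δ * ‖fderiv ℝ φ.toFun a w‖ - n * (n * (n.factorial *
      ‖π.orthogonalProjectionOnto (fderiv ℝ φ.toFun a w)‖)) := by
    have hz : π.orthogonalProjectionOnto (fderiv ℝ φ.toFun a w) = 0 :=
      Submodule.orthogonalProjectionOnto_eq_zero_iff.2 hvπ
    rw [hz]
    simpa [hδ] using hv0
  filter_upwards [h1.eventually (lt_mem_nhds hpos), φ.isOpen_dom.mem_nhds ha,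
    hcont.eventually_ne hv0] with b hb hbd hb0
  have hmem : fderiv ℝ φ.toFun b w ∈ tangentSpaceAt S (φ.toFun b) := by
    rw [φ.tangentSpaceAt_eq hbd]; exact ⟨w, rfl⟩
  have := subspaceWedge_orthogonal_mul_norm_le (tangentSpaceAt S (φ.toFun b)) π
    (by rw [φ.finrank_tangentSpaceAt hbd, hπ]) hmem
  exact le_of_mul_le_mul_right (by linarith) (norm_pos_iff.2 hb0)

variable [MeasurableSpace V] [BorelSpace V]

/-- The surface measure of `S` is locally finite. -/
theorem exists_hausdorffMeasure_lt_top {p : EuclideanSpace ℝ (Fin n)} (hp : p ∈ S)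
    (hp' : p ∈ φ.nhd) :
    ∃ W ∈ 𝓝 p, Measure.euclideanHausdorffMeasure (finrank ℝ V) (S ∩ W) < ∞ := by
  have ha := φ.inv_mem p ⟨hp, hp'⟩
  obtain ⟨K, s, hs, hK⟩ := (φ.contDiffAt ha).exists_lipschitzOnWith
  obtain ⟨r, hr, hrs⟩ := Metric.nhds_basis_closedBall.mem_iff.1 hs
  refine ⟨φ.inv ⁻¹' (Metric.closedBall (φ.inv p) r) ∩ φ.nhd, inter_mem
    ((φ.contDiffAt_inv hp').continuousAt (Metric.closedBall_mem_nhds _ hr))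
    (φ.isOpen_nhd.mem_nhds hp'), ?_⟩
  have hsub : S ∩ (φ.inv ⁻¹' (Metric.closedBall (φ.inv p) r) ∩ φ.nhd) ⊆
      φ.toFun '' (Metric.closedBall (φ.inv p) r) := fun x hx =>
    ⟨φ.inv x, hx.2.1, φ.toFun_inv x ⟨hx.1, hx.2.2⟩⟩
  refine (measure_mono hsub).trans_lt
    (((hK.mono hrs).euclideanHausdorffMeasure_image_le _).trans_lt ?_)
  rw [InnerProductSpace.euclideanHausdorffMeasure_eq_volume]
  exact ENNReal.mul_lt_top (ENNReal.pow_lt_top ENNReal.coe_lt_top)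
    (isCompact_closedBall _ _).measure_lt_top

/-- If the tangent space at `p` meets `πᗮ`, then arbitrarily close to `p` there are compact pieces
of `S` whose projection to `π` has measure small compared with their surface measure, and on which
the wedge factor is small. -/
theorem exists_small_projection {π : Submodule ℝ (EuclideanSpace ℝ (Fin n))}
    (hπ : finrank ℝ π = finrank ℝ V) {p : EuclideanSpace ℝ (Fin n)} (hp : p ∈ S)
    (hp' : p ∈ φ.nhd) (hT : tangentSpaceAt S p ⊓ πᗮ ≠ ⊥) {W : Set (EuclideanSpace ℝ (Fin n))}
    (hW : W ∈ 𝓝 p) {δ : ℝ≥0} (hδ : 0 < δ) :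
    ∃ C ⊆ S ∩ W, IsCompact C ∧ Measure.euclideanHausdorffMeasure (finrank ℝ V) C ≠ 0 ∧
      volume (π.orthogonalProjectionOnto '' C) ≤
        δ * Measure.euclideanHausdorffMeasure (finrank ℝ V) C ∧
      ∀ ξ ∈ C, subspaceWedge (tangentSpaceAt S ξ)ᗮ π ≤ δ := by
  set a := φ.inv p with ha_def
  have ha : a ∈ φ.dom := φ.inv_mem p ⟨hp, hp'⟩
  have hap : φ.toFun a = p := φ.toFun_inv p ⟨hp, hp'⟩
  obtain ⟨K, s, hs, hK⟩ := (φ.contDiffAt_inv hp').exists_lipschitzOnWith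
  -- The projection is read in the chart and, through an isometry of `π` with `V`, as a self-map of
  -- `V`; then its derivative has a determinant, which vanishes.
  let e : π ≃ₗᵢ[ℝ] V := (stdOrthonormalBasis ℝ π).equiv (stdOrthonormalBasis ℝ V) (finCongr hπ)
  let P : EuclideanSpace ℝ (Fin n) →L[ℝ] V :=
    (e.toContinuousLinearEquiv : π →L[ℝ] V).comp π.orthogonalProjectionOnto
  have hf : HasStrictFDerivAt (fun b => P (φ.toFun b)) (P.comp (fderiv ℝ φ.toFun a)) a :=
    P.hasStrictFDerivAt.comp a ((φ.contDiffAt ha).hasStrictFDerivAt (by norm_num))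
  have hdet : (P.comp (fderiv ℝ φ.toFun a)).det = 0 := by
    obtain ⟨v, ⟨hvT, hvπ⟩, hv0⟩ := (Submodule.ne_bot_iff _).1 hT
    rw [SetLike.mem_coe, ← hap, φ.tangentSpaceAt_eq ha] at hvT
    obtain ⟨w, rfl⟩ := hvT
    refine LinearMap.det_eq_zero_iff_ker_ne_bot.2 ((Submodule.ne_bot_iff _).2 ⟨w, ?_, ?_⟩)
    · rw [LinearMap.mem_ker]
      change e (π.orthogonalProjectionOnto (fderiv ℝ φ.toFun a w)) = 0
      have hz := Submodule.orthogonalProjectionOnto_eq_zero_iff.2 hvπ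
      exact (congrArg e hz).trans (map_zero e)
    · rintro rfl
      exact hv0 (map_zero _)
  -- The factor `(K + 1) ^ dim V` bounds the loss between Lebesgue measure on `V` and surface
  -- measure; `K + 1` instead of `K` keeps it positive.
  set m : ℝ≥0 := δ / (K + 1) ^ finrank ℝ V with hm
  have hmpos : 0 < m := by positivity
  have hev := addHaar_image_le_mul_of_det_lt (volume : Measure V)
    (P.comp (fderiv ℝ φ.toFun a)) (m := m) (by rw [hdet]; simpa using hmpos)
  obtain ⟨c, hc, hcpos⟩ := (hev.and self_mem_nhdsWithin).exists
  obtain ⟨s', hs', happ⟩ := hf.approximates_deriv_on_nhds (Or.inr hcpos)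
  have hcontφ : ContinuousAt φ.toFun a := (φ.contDiffAt ha).continuousAt
  have hwedge := φ.eventually_subspaceWedge_le hπ ha (by rwa [hap]) (NNReal.coe_pos.2 hδ)
  rw [← hap] at hs hW
  obtain ⟨r, hr, hball⟩ := Metric.nhds_basis_closedBall.mem_iff.1
    (inter_mem (inter_mem (inter_mem (inter_mem hs' (φ.isOpen_dom.mem_nhds ha)) (hcontφ hs))
      (hcontφ hW)) hwedge)
  set B := Metric.closedBall a r with hB
  have hBdom : B ⊆ φ.dom := fun b hb => (hball hb).1.1.1.2
  have hvol : volume B ≤ (K + 1 : ℝ≥0) ^ finrank ℝ V *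
      Measure.euclideanHausdorffMeasure (finrank ℝ V) (φ.toFun '' B) := by
    have hK' : LipschitzOnWith (K + 1) φ.inv (φ.toFun '' B) := by
      refine (hK.weaken (by simp)).mono ?_
      rintro _ ⟨b, hb, rfl⟩
      exact (hball hb).1.1.2
    have h := hK'.euclideanHausdorffMeasure_image_le (finrank ℝ V)
    have himg : φ.inv '' (φ.toFun '' B) = B := by
      rw [Set.image_image]
      conv_rhs => rw [← Set.image_id B]
      exact Set.image_congr fun b hb => φ.inv_toFun b (hBdom hb)
    rwa [himg, InnerProductSpace.euclideanHausdorffMeasure_eq_volume] at h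
  have hBpos : 0 < volume B := Metric.measure_closedBall_pos _ _ hr
  refine ⟨φ.toFun '' B, ?_, (isCompact_closedBall a r).image_of_continuousOn
    (φ.contDiffOn.continuousOn.mono hBdom), ?_, ?_, ?_⟩
  · rintro _ ⟨b, hb, rfl⟩
    exact ⟨(φ.toFun_mem b (hBdom hb)).1, (hball hb).1.2⟩
  · intro h0
    rw [h0, mul_zero] at hvol
    exact hBpos.ne' (le_antisymm hvol bot_le)
  · have h1 : volume (π.orthogonalProjectionOnto '' (φ.toFun '' B)) =
        volume ((fun b => P (φ.toFun b)) '' B) := by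
      have h2 : (fun b => P (φ.toFun b)) '' B =
          e '' (π.orthogonalProjectionOnto '' (φ.toFun '' B)) := by
        simp only [Set.image_image]; rfl
      rw [h2, ← InnerProductSpace.euclideanHausdorffMeasure_eq_volume (V := V),
        e.isometry.euclideanHausdorffMeasure_image, ← hπ,
        InnerProductSpace.euclideanHausdorffMeasure_eq_volume]
    rw [h1]
    calc _ ≤ m * volume B := hc B _ (happ.mono_set fun b hb => (hball hb).1.1.1.1)
      _ ≤ m * ((K + 1 : ℝ≥0) ^ finrank ℝ V *
          Measure.euclideanHausdorffMeasure (finrank ℝ V) (φ.toFun '' B)) := by gcongr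
      _ = _ := by
        rw [← mul_assoc, ← ENNReal.coe_pow, ← ENNReal.coe_mul, hm,
          div_mul_cancel₀ _ (by positivity)]
  · rintro _ ⟨b, hb, rfl⟩
    exact (hball hb).2

end LocalParam

/-- A square integrable `G` which satisfies `G² ≥ 2⁻ʲ / σ(C j)` on each of the sets `C j`. -/
theorem exists_density_of_pieces {X : Type*} [MeasurableSpace X] (σ : Measure X) (C : ℕ → Set X)
    (hC : ∀ j, MeasurableSet (C j)) (h0 : ∀ j, σ (C j) ≠ 0) (hfin : ∀ j, σ (C j) ≠ ∞) :
    ∃ G : X → ℝ, Measurable G ∧ (∀ x, 0 ≤ G x) ∧ (∀ x, (∀ j, x ∉ C j) → G x = 0) ∧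
      ∫⁻ x, ENNReal.ofReal (G x ^ 2) ∂σ < ∞ ∧
      ∀ j, ∀ᵐ x ∂σ, x ∈ C j → (2⁻¹ : ℝ≥0∞) ^ j / σ (C j) ≤ ENNReal.ofReal (G x ^ 2) := by
  -- `G` is the square root of the sum `H` of normalized indicator functions, which is integrable
  -- and hence almost everywhere finite; where it is infinite, `toReal` returns `0`.
  set H : X → ℝ≥0∞ := fun x => ∑' j, (C j).indicator (fun _ => (2⁻¹ : ℝ≥0∞) ^ j / σ (C j)) x with hH
  have hHm : Measurable H := Measurable.tsum fun j => measurable_const.indicator (hC j)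
  have hint : ∫⁻ x, H x ∂σ = 2 := by
    rw [lintegral_tsum fun j => (measurable_const.indicator (hC j)).aemeasurable]
    refine (tsum_congr fun j => ?_).trans ENNReal.tsum_geometric_two
    rw [lintegral_indicator_const (hC j), ENNReal.div_mul_cancel (h0 j) (hfin j)]
  have hlt : ∀ᵐ x ∂σ, H x < ∞ := ae_lt_top hHm (by rw [hint]; simp)
  have hsq : ∀ x, Real.sqrt (H x).toReal ^ 2 = (H x).toReal := fun x =>
    Real.sq_sqrt ENNReal.toReal_nonneg
  refine ⟨fun x => Real.sqrt (H x).toReal, hHm.ennreal_toReal.sqrt, fun x => Real.sqrt_nonneg _,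
    fun x hx => ?_, ?_, fun j => ?_⟩
  · have : H x = 0 := by simp [hH, hx]
    simp [this]
  · simp only [hsq]
    refine (lintegral_mono fun x => ENNReal.ofReal_toReal_le).trans_lt ?_
    rw [hint]; simp
  · filter_upwards [hlt] with x hx hxC
    rw [hsq, ENNReal.ofReal_toReal hx.ne]
    refine le_trans ?_ (ENNReal.le_tsum j)
    simp [hxC]

end Degenerate

/-! ### Infinite data where transversality fails -/

section Infinite

open scoped NNReal RealInnerProductSpace FourierTransform

/-- For a frequency in the plane `π + y`, the phase splits into the projection to `π` and a
modulation by `y`. -/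
theorem inner_coe_add_eq_inner_projection_add {n : ℕ}
    {π : Submodule ℝ (EuclideanSpace ℝ (Fin n))} (x : π) (y ξ : EuclideanSpace ℝ (Fin n)) :
    ⟪(x : EuclideanSpace ℝ (Fin n)) + y, ξ⟫ = ⟪π.orthogonalProjectionOnto ξ, x⟫ + ⟪y, ξ⟫ := by
  rw [inner_add_left, Submodule.inner_orthogonalProjectionOnto_eq_of_mem_right, real_inner_comm]

theorem fourierChar_neg_eq_exp (t : ℝ) :
    ((𝐞 (-t) : Circle) : ℂ) = Complex.exp (-2 * Real.pi * Complex.I * (t : ℝ)) := by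
  rw [Real.fourierChar_apply]
  congr 1
  push_cast
  ring

theorem eq_top_of_forall_two_pow_le {I : ℝ≥0∞} (h : ∀ j : ℕ, (2 : ℝ≥0∞) ^ j ≤ I) : I = ∞ := by
  refine ENNReal.eq_top_of_forall_nnreal_le fun r => ?_
  obtain ⟨j, hj⟩ := exists_nat_gt r
  refine le_trans ?_ (h j)
  have : r ≤ 2 ^ j := hj.le.trans (by exact_mod_cast (Nat.lt_two_pow_self (n := j)).le)
  exact_mod_cast this

theorem inv_coe_inv_four_pow (j : ℕ) : ((4⁻¹ ^ j : ℝ≥0) : ℝ≥0∞)⁻¹ = 4 ^ j := by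
  rw [ENNReal.coe_pow, ENNReal.coe_inv (by norm_num), ENNReal.inv_pow, inv_inv]
  rfl

theorem four_pow_mul_inv_two_pow (j : ℕ) : (4 : ℝ≥0∞) ^ j * 2⁻¹ ^ j = 2 ^ j := by
  rw [← mul_pow, show (4 : ℝ≥0∞) = 2 * 2 by norm_num, mul_assoc,
    ENNReal.mul_inv_cancel (by norm_num) (by norm_num), mul_one]

/-- Where the tangent space meets `πᗮ` there is a compactly supported `L²` density for which both
the tomographic data at a prescribed `y` and the geometric energy are infinite. -/
theorem exists_isCompactDensity_eq_top {n k : ℕ} {S : Set (EuclideanSpace ℝ (Fin n))}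
    (hS : IsC1Submanifold k S) {π : Submodule ℝ (EuclideanSpace ℝ (Fin n))}
    (hπ : finrank ℝ π = k) {p : EuclideanSpace ℝ (Fin n)} (hp : p ∈ S)
    (hT : tangentSpaceAt S p ⊓ πᗮ ≠ ⊥) (y : EuclideanSpace ℝ (Fin n)) :
    ∃ g : EuclideanSpace ℝ (Fin n) → ℂ, IsCompactDensity k S g ∧
      tomographicData k S g π y = ∞ ∧ geometricEnergy k S g π = ∞ := by
  obtain ⟨V, hV, φ, hpφ⟩ := hS.exists_localParam hp
  have hπV : finrank ℝ π = finrank ℝ V := by rw [hπ, hV]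
  subst hV
  set P := π.orthogonalProjectionOnto with hP
  set σ := surfaceMeasure (finrank ℝ V) S with hσ
  obtain ⟨W, hW, hWfin⟩ := φ.exists_hausdorffMeasure_lt_top hp hpφ
  obtain ⟨r, hr, hball⟩ := Metric.nhds_basis_closedBall.mem_iff.1
    (inter_mem hW (φ.isOpen_nhd.mem_nhds hpφ))
  set K := S ∩ Metric.closedBall p r with hK
  have hKc : IsCompact K :=
    φ.isCompact_inter _ (fun x hx => (hball hx).2) (isCompact_closedBall p r)
  have hσapp : ∀ A : Set (EuclideanSpace ℝ (Fin n)), MeasurableSet A → A ⊆ S →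
      σ A = Measure.euclideanHausdorffMeasure (finrank ℝ V) A := fun A hA hAS => by
    rw [hσ, surfaceMeasure, Measure.restrict_apply hA, Set.inter_eq_left.2 hAS]
  have hKfin : σ K < ∞ := by
    rw [hσapp K hKc.measurableSet Set.inter_subset_left]
    exact (measure_mono (Set.inter_subset_inter_right S fun x hx => (hball hx).1)).trans_lt hWfin
  have hpieces : ∀ j : ℕ, ∃ C ⊆ K, IsCompact C ∧ σ C ≠ 0 ∧
      volume (P '' C) ≤ ((4⁻¹ ^ j : ℝ≥0) : ℝ≥0∞) * σ C ∧
      ∀ ξ ∈ C, subspaceWedge (tangentSpaceAt S ξ)ᗮ π ≤ ((4⁻¹ ^ j : ℝ≥0) : ℝ) := fun j => by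
    obtain ⟨C, hCK, hC, h0, hv, hw⟩ := φ.exists_small_projection hπV hp hpφ hT
      (Metric.closedBall_mem_nhds p hr) (δ := 4⁻¹ ^ j) (by positivity)
    have := hσapp C hC.measurableSet (hCK.trans Set.inter_subset_left)
    exact ⟨C, hCK, hC, by rwa [this], by rwa [this], hw⟩
  choose C hCK hC hC0 hCv hCw using hpieces
  have hCfin : ∀ j, σ (C j) ≠ ∞ := fun j => ((measure_mono (hCK j)).trans_lt hKfin).ne
  obtain ⟨G, hGm, hG0, hGsupp, hGint, hGge⟩ :=
    exists_density_of_pieces σ C (fun j => (hC j).measurableSet) hC0 hCfin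
  have hGK : ∀ x ∉ K, G x = 0 := fun x hx => hGsupp x fun j h => hx (hCK j h)
  -- The phase cancels the modulation by `y`, so that on `π + y` the Fourier extension of `g` is the
  -- Fourier transform of the positive measure `ν` below.
  set g : EuclideanSpace ℝ (Fin n) → ℂ :=
    fun ξ => G ξ * Complex.exp (2 * Real.pi * Complex.I * (⟪y, ξ⟫ : ℝ)) with hg
  have hgnorm : ∀ ξ, ‖g ξ‖ = G ξ := fun ξ => by
    have : 2 * Real.pi * Complex.I * (⟪y, ξ⟫ : ℝ) =
        ((2 * Real.pi * ⟪y, ξ⟫ : ℝ) : ℂ) * Complex.I := by push_cast; ring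
    rw [hg]
    simp only
    rw [norm_mul, this, Complex.norm_exp_ofReal_mul_I, mul_one, Complex.norm_real,
      Real.norm_of_nonneg (hG0 ξ)]
  have hgm : Measurable g := by
    have : Continuous fun ξ : EuclideanSpace ℝ (Fin n) =>
        Complex.exp (2 * Real.pi * Complex.I * (⟪y, ξ⟫ : ℝ)) := by fun_prop
    exact (Complex.measurable_ofReal.comp hGm).mul this.measurable
  have hg2 : MemLp g 2 σ := by
    refine ⟨hgm.aestronglyMeasurable, ?_⟩
    have h := hGint
    have e : ∫⁻ x, ENNReal.ofReal (G x ^ 2) ∂σ = eLpNorm g 2 σ ^ 2 := by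
      rw [← lintegral_ofReal_norm_sq]; simp only [hgnorm]
    rw [e] at h
    exact (ENNReal.pow_lt_top_iff.1 h).resolve_right (by norm_num)
  have hg1 : Integrable g σ := by
    have : Fact (σ K < ∞) := ⟨hKfin⟩
    have h1 : IntegrableOn g K σ :=
      memLp_one_iff_integrable.1 ((hg2.restrict K).mono_exponent (by norm_num))
    exact (integrableOn_iff_integrable_of_support_subset fun x hx => by
      by_contra hxK
      exact hx (norm_eq_zero.1 (by rw [hgnorm, hGK x hxK]))).1 h1
  have hsupp : tsupport g ⊆ K := closure_minimal (fun x hx => by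
      by_contra hxK
      exact hx (norm_eq_zero.1 (by rw [hgnorm, hGK x hxK]))) hKc.isClosed
  have hGi : Integrable G σ := by
    have := hg1.norm
    simpa only [hgnorm] using this
  refine ⟨g, ⟨hg2, hg1, hKc.of_isClosed_subset (isClosed_tsupport g) hsupp,
    hsupp.trans Set.inter_subset_left⟩, ?_, ?_⟩
  · set ν : Measure π := (σ.withDensity fun x => ENNReal.ofReal (G x)).map P with hν
    have : IsFiniteMeasure (σ.withDensity fun x => ENNReal.ofReal (G x)) :=
      isFiniteMeasure_withDensity_ofReal hGi.2
    have hPm : Measurable P := P.continuous.measurable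
    have hfour : ∀ x : π, fourierExtension (finrank ℝ V) S g (x + y) =
        ∫ u, 𝐞 (-⟪u, x⟫) • (1 : ℂ) ∂ν := fun x => by
      have hcont : Continuous fun u : π => 𝐞 (-⟪u, x⟫) • (1 : ℂ) := by
        simp only [Circle.smul_def]
        have := Real.continuous_fourierChar
        fun_prop
      rw [hν, integral_map hPm.aemeasurable hcont.aestronglyMeasurable,
        integral_withDensity_eq_integral_toReal_smul hGm.ennreal_ofReal
          (ae_of_all _ fun _ => ENNReal.ofReal_lt_top)]
      refine integral_congr_ae (ae_of_all _ fun ξ => ?_)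
      simp only
      rw [inner_coe_add_eq_inner_projection_add, ENNReal.toReal_ofReal (hG0 ξ), Circle.smul_def,
        fourierChar_neg_eq_exp, hg, mul_assoc, ← Complex.exp_add, smul_eq_mul, mul_one,
        Complex.real_smul]
      congr 2
      push_cast
      ring
    set I := ∫⁻ x, ENNReal.ofReal (‖∫ u, 𝐞 (-⟪u, x⟫) • (1 : ℂ) ∂ν‖ ^ 2) with hI
    have hTI : tomographicData (finrank ℝ V) S g π y = I := by
      rw [tomographicData, planeTransform]
      simp only [hfour, hI]
    rw [hTI]
    by_contra hItop
    refine hItop (eq_top_of_forall_two_pow_le fun j => ?_)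
    have hPC : IsCompact (P '' C j) := (hC j).image P.continuous
    have hmain := measure_sq_le_mul_lintegral_norm_sq ν hPC hItop
    have hνge : (2⁻¹ : ℝ≥0∞) ^ j * σ (C j) ≤ ν (P '' C j) ^ 2 := by
      set a := (2⁻¹ : ℝ≥0∞) ^ j / σ (C j) with ha
      have hroot : (a ^ (2⁻¹ : ℝ)) ^ 2 = a := by
        rw [← ENNReal.rpow_natCast, ← ENNReal.rpow_mul]; norm_num
      have h1 : a ^ (2⁻¹ : ℝ) * σ (C j) ≤ ν (P '' C j) := by
        rw [hν, Measure.map_apply hPm hPC.measurableSet]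
        refine le_trans ?_ (measure_mono (Set.subset_preimage_image P (C j)))
        rw [withDensity_apply _ (hC j).measurableSet, ← setLIntegral_const]
        refine lintegral_mono_ae ?_
        filter_upwards [ae_restrict_mem (hC j).measurableSet,
          ae_restrict_of_ae (hGge j)] with ξ hξ hξG
        rw [← ENNReal.pow_le_pow_left_iff two_ne_zero, hroot, ← ENNReal.ofReal_pow (hG0 ξ)]
        exact hξG hξ
      calc (2⁻¹ : ℝ≥0∞) ^ j * σ (C j) = a * σ (C j) * σ (C j) := by
            rw [ha, ENNReal.div_mul_cancel (hC0 j) (hCfin j)]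
        _ = (a ^ (2⁻¹ : ℝ) * σ (C j)) ^ 2 := by rw [mul_pow, hroot]; ring
        _ ≤ _ := by gcongr
    have h1 := hνge.trans (hmain.trans (mul_le_mul_left (hCv j) I))
    have h2 : (2⁻¹ : ℝ≥0∞) ^ j ≤ ((4⁻¹ ^ j : ℝ≥0) : ℝ≥0∞) * I := by
      rw [← ENNReal.mul_le_mul_iff_left (hC0 j) (hCfin j)]
      calc _ ≤ _ := h1
        _ = _ := by ring
    calc (2 : ℝ≥0∞) ^ j = 4 ^ j * 2⁻¹ ^ j := (four_pow_mul_inv_two_pow j).symm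
      _ ≤ 4 ^ j * (((4⁻¹ ^ j : ℝ≥0) : ℝ≥0∞) * I) := by gcongr
      _ = I := by
        rw [← inv_coe_inv_four_pow, ← mul_assoc, ENNReal.inv_mul_cancel (by simp) (by simp),
          one_mul]
  · refine eq_top_of_forall_two_pow_le fun j => ?_
    rw [geometricEnergy]
    calc (2 : ℝ≥0∞) ^ j = ((2⁻¹ : ℝ≥0∞) ^ j / σ (C j)) / ((4⁻¹ ^ j : ℝ≥0) : ℝ≥0∞) * σ (C j) := by
          rw [← four_pow_mul_inv_two_pow, ← inv_coe_inv_four_pow, div_eq_mul_inv _ (_ : ℝ≥0∞),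
            mul_right_comm, ENNReal.div_mul_cancel (hC0 j) (hCfin j), mul_comm]
      _ = ∫⁻ ξ in C j, ((2⁻¹ : ℝ≥0∞) ^ j / σ (C j)) / ((4⁻¹ ^ j : ℝ≥0) : ℝ≥0∞) ∂σ := by
          rw [setLIntegral_const]
      _ ≤ ∫⁻ ξ in C j, ENNReal.ofReal (‖g ξ‖ ^ 2) /
            ENNReal.ofReal (subspaceWedge (tangentSpaceAt S ξ)ᗮ π) ∂σ := by
          refine lintegral_mono_ae ?_
          filter_upwards [ae_restrict_mem (hC j).measurableSet,
            ae_restrict_of_ae (hGge j)] with ξ hξ hξG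
          rw [hgnorm]
          refine ENNReal.div_le_div (hξG hξ) (ENNReal.ofReal_le_of_le_toReal ?_)
          exact hCw j ξ hξ
      _ ≤ _ := setLIntegral_le_lintegral _ _

end Infinite

/-! ### Transverse caps as graphs over the subspace -/

section Transverse

open scoped NNReal RealInnerProductSpace FourierTransform

namespace LocalParam

variable {n : ℕ} {S : Set (EuclideanSpace ℝ (Fin n))} {V : Type*}
    [NormedAddCommGroup V] [InnerProductSpace ℝ V] [FiniteDimensional ℝ V] (φ : LocalParam S V)

/-- Where the tangent space is transverse to `πᗮ`, the orthogonal projection to `π` has a Lipschitz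
section on a piece of `S`, and it maps neighbourhoods in `S` to neighbourhoods in `π`. -/
theorem exists_lipschitz_section {π : Submodule ℝ (EuclideanSpace ℝ (Fin n))}
    (hπ : finrank ℝ π = finrank ℝ V) {p : EuclideanSpace ℝ (Fin n)} (hp : p ∈ S)
    (hp' : p ∈ φ.nhd) (hT : tangentSpaceAt S p ⊓ πᗮ = ⊥) :
    (∃ W ∈ 𝓝 p, ∃ (K : ℝ≥0) (s : π → EuclideanSpace ℝ (Fin n)), LipschitzWith K s ∧
      ∀ x ∈ S ∩ W, s (π.orthogonalProjectionOnto x) = x) ∧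
    ∀ W ∈ 𝓝 p, π.orthogonalProjectionOnto '' (S ∩ W) ∈ 𝓝 (π.orthogonalProjectionOnto p) := by
  set a := φ.inv p with ha_def
  have ha : a ∈ φ.dom := φ.inv_mem p ⟨hp, hp'⟩
  have hap : φ.toFun a = p := φ.toFun_inv p ⟨hp, hp'⟩
  have hcontφ : ContinuousAt φ.toFun a := (φ.contDiffAt ha).continuousAt
  set P := π.orthogonalProjectionOnto with hP
  have hinj : Function.Injective (P.comp (fderiv ℝ φ.toFun a)) := by
    refine (injective_iff_map_eq_zero _).2 fun w hw => ?_
    have h1 : fderiv ℝ φ.toFun a w ∈ πᗮ := Submodule.orthogonalProjectionOnto_eq_zero_iff.1 hw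
    have h2 : fderiv ℝ φ.toFun a w ∈ tangentSpaceAt S p := by
      rw [← hap, φ.tangentSpaceAt_eq ha]; exact ⟨w, rfl⟩
    have h3 : fderiv ℝ φ.toFun a w ∈ tangentSpaceAt S p ⊓ πᗮ := ⟨h2, h1⟩
    rw [hT, Submodule.mem_bot] at h3
    exact φ.injective_fderiv ha (h3.trans (map_zero _).symm)
  let L : V ≃L[ℝ] π := (LinearEquiv.ofInjectiveOfFinrankEq
    (P.comp (fderiv ℝ φ.toFun a)).toLinearMap hinj hπ.symm).toContinuousLinearEquiv
  have hL : (L : V →L[ℝ] π) = P.comp (fderiv ℝ φ.toFun a) := by ext w; rfl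
  have hf : HasStrictFDerivAt (fun b => P (φ.toFun b)) (L : V →L[ℝ] π) a := by
    rw [hL]
    exact P.hasStrictFDerivAt.comp a ((φ.contDiffAt ha).hasStrictFDerivAt (by norm_num))
  constructor
  · have hg := hf.to_localInverse
    have hga : hf.localInverse _ _ _ (P (φ.toFun a)) = a := hf.localInverse_apply_image
    have hs : HasStrictFDerivAt (fun u => φ.toFun (hf.localInverse _ _ _ u))
        ((fderiv ℝ φ.toFun a).comp (L.symm : π →L[ℝ] V)) (P (φ.toFun a)) := by
      refine HasStrictFDerivAt.comp _ ?_ hg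
      rw [hga]
      exact (φ.contDiffAt ha).hasStrictFDerivAt (by norm_num)
    obtain ⟨K, N, hN, hK⟩ := hs.exists_lipschitzOnWith
    obtain ⟨s, hs, hEq⟩ := hK.extend_finite_dimension
    rw [hap] at hN
    refine ⟨(P ⁻¹' N ∩ φ.nhd) ∩
      φ.inv ⁻¹' {b | hf.localInverse _ _ _ (P (φ.toFun b)) = b}, inter_mem (inter_mem
        (P.continuous.continuousAt hN) (φ.isOpen_nhd.mem_nhds hp'))
        ((φ.contDiffAt_inv hp').continuousAt hf.eventually_left_inverse), _, s, hs, ?_⟩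
    rintro x ⟨hx, ⟨hxN, hxO⟩, hxl⟩
    have hxi : φ.toFun (φ.inv x) = x := φ.toFun_inv x ⟨hx, hxO⟩
    rw [Set.mem_preimage, Set.mem_ofPred_eq, hxi] at hxl
    rw [← hEq hxN]
    simp only
    rw [hxl, hxi]
  · intro W hW
    rw [← hap] at hW ⊢
    have h1 : (φ.dom ∩ φ.toFun ⁻¹' W) ∈ 𝓝 a := inter_mem (φ.isOpen_dom.mem_nhds ha) (hcontφ hW)
    have h2 : (fun b => P (φ.toFun b)) '' (φ.dom ∩ φ.toFun ⁻¹' W) ∈ 𝓝 (P (φ.toFun a)) := by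
      rw [← hf.map_nhds_eq_of_equiv]
      exact image_mem_map h1
    refine mem_of_superset h2 ?_
    rintro _ ⟨b, hb, rfl⟩
    exact ⟨φ.toFun b, ⟨(φ.toFun_mem b hb.1).1, hb.2⟩, rfl⟩

end LocalParam

/-- The surface measure on `C` is pushed forward by the orthogonal projection to the measure with
bounded density `J` on `π`, positive almost everywhere on the projection of `C`. The map `s` stands
for a section of the projection over `C`; it is only required to take values in `C` where `J` does
not vanish. -/
structure IsGraphDensity {n : ℕ} (k : ℕ) (π : Submodule ℝ (EuclideanSpace ℝ (Fin n)))
    (C : Set (EuclideanSpace ℝ (Fin n))) (s : π → EuclideanSpace ℝ (Fin n)) (J : π → ℝ) : Prop where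
  measurable : Measurable J
  integrable : Integrable J
  nonneg : ∀ u, 0 ≤ J u
  bounded : ∃ M, ∀ u, J u ≤ M
  section_mem : ∀ u, J u ≠ 0 → s u ∈ C
  pos : ∀ᵐ u, u ∈ π.orthogonalProjectionOnto '' C → 0 < J u
  setIntegral_comp : ∀ h : π → ℂ, Continuous h →
    ∫ ξ in C, h (π.orthogonalProjectionOnto ξ) ∂(Measure.euclideanHausdorffMeasure k) =
      ∫ u, J u • h u

/-- A bounded piece of a set over which the projection to `π` has a Lipschitz section carries a
bounded density. It is obtained from the Radon-Nikodym theorem: the section is Lipschitz, so the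
push-forward is at most a multiple of Lebesgue measure, and the projection is `1`-Lipschitz, so the
push-forward is at least Lebesgue measure on the projection of the piece. -/
theorem exists_isGraphDensity {n k : ℕ} {π : Submodule ℝ (EuclideanSpace ℝ (Fin n))}
    (hπ : finrank ℝ π = k) {C : Set (EuclideanSpace ℝ (Fin n))} (hC : MeasurableSet C)
    (hCb : Bornology.IsBounded C)
    {s : π → EuclideanSpace ℝ (Fin n)} {K : ℝ≥0} (hs : LipschitzWith K s)
    (hsC : ∀ x ∈ C, s (π.orthogonalProjectionOnto x) = x) :
    ∃ J : π → ℝ, IsGraphDensity k π C s J := by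
  subst hπ
  set P := π.orthogonalProjectionOnto with hP
  have hPm : Measurable P := P.continuous.measurable
  set μ : Measure (EuclideanSpace ℝ (Fin n)) :=
    Measure.euclideanHausdorffMeasure (finrank ℝ π) with hμ
  set D := P '' C with hD
  have hDeq : D = {u | s u ∈ C ∧ P (s u) = u} := by
    ext u
    constructor
    · rintro ⟨x, hx, rfl⟩
      rw [Set.mem_ofPred_eq, hsC x hx]
      exact ⟨hx, rfl⟩
    · rintro ⟨h1, h2⟩
      exact ⟨s u, h1, h2⟩
  have hDm : MeasurableSet D := by
    rw [hDeq]
    exact (hs.continuous.measurable hC).inter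
      (measurableSet_eq_fun (hPm.comp hs.continuous.measurable) measurable_id)
  have hDfin : volume D < ∞ := (P.lipschitz.isBounded_image hCb).measure_lt_top
  set c : ℝ≥0∞ := (K : ℝ≥0∞) ^ finrank ℝ π with hc
  have hcfin : c ≠ ∞ := ENNReal.pow_ne_top ENNReal.coe_ne_top
  set ν : Measure π := (μ.restrict C).map P with hν
  have hνapp : ∀ A, MeasurableSet A → ν A = μ (P ⁻¹' A ∩ C) := fun A hA => by
    rw [hν, Measure.map_apply hPm hA, Measure.restrict_apply (hPm hA)]
  have hνle : ∀ A, MeasurableSet A → ν A ≤ c * volume A := fun A hA => by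
    rw [hνapp A hA]
    have hsub : P ⁻¹' A ∩ C ⊆ s '' A := fun x hx => ⟨P x, hx.1, hsC x hx.2⟩
    refine (measure_mono hsub).trans ?_
    have := (hs.lipschitzOnWith (s := A)).euclideanHausdorffMeasure_image_le (finrank ℝ π)
    rwa [InnerProductSpace.euclideanHausdorffMeasure_eq_volume] at this
  have hνge : ∀ A, MeasurableSet A → A ⊆ D → volume A ≤ ν A := fun A hA hAD => by
    rw [hνapp A hA]
    have hsub : A ⊆ P '' (P ⁻¹' A ∩ C) := fun u hu => by
      obtain ⟨x, hx, rfl⟩ := hAD hu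
      exact ⟨x, ⟨hu, hx⟩, rfl⟩
    refine (measure_mono hsub).trans ?_
    have := (π.lipschitzWith_orthogonalProjectionOnto.lipschitzOnWith
      (s := P ⁻¹' A ∩ C)).euclideanHausdorffMeasure_image_le (finrank ℝ π)
    rw [InnerProductSpace.euclideanHausdorffMeasure_eq_volume] at this
    simpa using this
  have hνD : ν Dᶜ = 0 := by
    rw [hνapp _ hDm.compl]
    convert measure_empty (μ := μ)
    ext x
    simp only [Set.mem_inter_iff, Set.mem_preimage, Set.mem_compl_iff, Set.mem_empty_iff_false,
      iff_false, not_and]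
    exact fun h hx => h ⟨x, hx, rfl⟩
  have hνfin : IsFiniteMeasure ν := ⟨by
    rw [← Set.compl_union_self D]
    refine (measure_union_le _ _).trans_lt ?_
    rw [hνD, zero_add]
    exact (hνle D hDm).trans_lt (ENNReal.mul_lt_top hcfin.lt_top hDfin)⟩
  have hac : ν ≪ volume := Measure.AbsolutelyContinuous.mk fun A hA h0 => by
    have := hνle A hA
    rw [h0, mul_zero] at this
    exact le_antisymm this bot_le
  set R := ν.rnDeriv volume with hR
  have hRm : Measurable R := Measure.measurable_rnDeriv _ _
  have hRint : ∀ A, ∫⁻ u in A, R u = ν A := fun A => Measure.setLIntegral_rnDeriv hac A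
  have hRle : ∀ᵐ u, R u ≤ c := by
    refine ae_le_of_forall_setLIntegral_le_of_sigmaFinite hRm fun A hA _ => ?_
    rw [hRint, setLIntegral_const]
    exact hνle A hA
  have hR0 : ∀ᵐ u, u ∉ D → R u = 0 := by
    have h := hRint Dᶜ
    rw [hνD, lintegral_eq_zero_iff hRm] at h
    exact (ae_restrict_iff' hDm.compl).1 h
  have hRpos : ∀ᵐ u, u ∈ D → R u ≠ 0 := by
    have hA : MeasurableSet (D ∩ {u | R u = 0}) := hDm.inter (hRm (measurableSet_singleton 0))
    have h1 : ν (D ∩ {u | R u = 0}) = 0 := by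
      rw [← hRint, setLIntegral_congr_fun hA (g := fun _ => 0) fun u hu => hu.2]
      simp
    have h2 : volume (D ∩ {u | R u = 0}) = 0 :=
      le_antisymm ((hνge _ hA Set.inter_subset_left).trans h1.le) bot_le
    rw [ae_iff]
    convert h2 using 2
    ext u; simp
  -- A version of the Radon-Nikodym derivative that is bounded, and zero off `D`, everywhere.
  set J : π → ℝ := D.indicator fun u => min (R u).toReal c.toReal with hJ
  have hJm : Measurable J := (hRm.ennreal_toReal.min measurable_const).indicator hDm
  have hJ0 : ∀ u, 0 ≤ J u := fun u => Set.indicator_nonneg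
    (fun u _ => le_min ENNReal.toReal_nonneg ENNReal.toReal_nonneg) u
  have hJle : ∀ u, J u ≤ c.toReal := fun u => Set.indicator_le'
    (fun u _ => min_le_right _ _) (fun _ _ => ENNReal.toReal_nonneg) u
  have hJR : ∀ᵐ u, J u = (R u).toReal := by
    filter_upwards [hRle, hR0] with u h1 h2
    by_cases hu : u ∈ D
    · rw [hJ, Set.indicator_of_mem hu, min_eq_left (ENNReal.toReal_mono hcfin h1)]
    · rw [hJ, Set.indicator_of_notMem hu, h2 hu, ENNReal.toReal_zero]
  refine ⟨J, hJm, ?_, hJ0, ⟨c.toReal, hJle⟩, ?_, ?_, ?_⟩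
  · have : IsFiniteMeasure (volume.restrict D) := ⟨by simpa using hDfin⟩
    have h1 : IntegrableOn J D := Integrable.of_bound hJm.aestronglyMeasurable c.toReal
      (ae_of_all _ fun u => by rw [Real.norm_of_nonneg (hJ0 u)]; exact hJle u)
    exact (integrableOn_iff_integrable_of_support_subset Set.support_indicator_subset).1 h1
  · intro u hu
    have : u ∈ D := Set.mem_of_indicator_ne_zero hu
    rw [hDeq] at this
    exact this.1
  · filter_upwards [hJR, hRle, hRpos] with u h1 h2 h3 hu
    rw [h1]
    exact ENNReal.toReal_pos (h3 hu) (ne_top_of_le_ne_top hcfin h2)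
  · intro h hh
    have h1 : ∫ ξ in C, h (P ξ) ∂μ = ∫ u, h u ∂ν := by
      rw [hν, integral_map hPm.aemeasurable hh.aestronglyMeasurable]
    rw [h1, ← Measure.withDensity_rnDeriv_eq ν volume hac,
      integral_withDensity_eq_integral_toReal_smul hRm
        (hRle.mono fun u hu => hu.trans_lt hcfin.lt_top)]
    exact integral_congr_ae (hJR.mono fun u hu => by simp only [hu])

/-- For `t` so small that all phases `2π t q` lie in `(0, π)`, the derivative in `t` is negative. -/
theorem eventually_exists_hasDerivAt_integral_cos {X : Type*} [MeasurableSpace X] {μ : Measure X}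
    {w q : X → ℝ} (hw : Integrable w μ) (hq : AEStronglyMeasurable q μ) (hw0 : ∀ x, 0 ≤ w x)
    {c M : ℝ} (hc : 0 < c) (hqw : ∀ x, w x ≠ 0 → c ≤ q x ∧ q x ≤ M) (hpos : 0 < ∫ x, w x ∂μ) :
    ∀ᶠ t in 𝓝[>] (0 : ℝ), ∃ D : ℝ, D ≠ 0 ∧
      HasDerivAt (fun t => ∫ x, w x * Real.cos (2 * Real.pi * (t * q x)) ∂μ) D t := by
  have hM : 0 < M := by
    by_contra hM
    have : ∀ x, w x = 0 := fun x => by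
      by_contra hx
      have := hqw x hx
      linarith
    simp [this] at hpos
  have hmeas : ∀ t : ℝ, AEStronglyMeasurable (fun x => Real.cos (2 * Real.pi * (t * q x))) μ :=
    fun t => Real.continuous_cos.comp_aestronglyMeasurable ((hq.const_mul t).const_mul _)
  have hmeas' : ∀ t : ℝ, AEStronglyMeasurable (fun x => Real.sin (2 * Real.pi * (t * q x))) μ :=
    fun t => Real.continuous_sin.comp_aestronglyMeasurable ((hq.const_mul t).const_mul _)
  have hbound : ∀ t x, ‖w x * (-Real.sin (2 * Real.pi * (t * q x)) * (2 * Real.pi * q x))‖ ≤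
      w x * (2 * Real.pi * M) := fun t x => by
    by_cases hx : w x = 0
    · simp [hx]
    · obtain ⟨h1, h2⟩ := hqw x hx
      rw [norm_mul, Real.norm_of_nonneg (hw0 x), norm_mul, norm_neg]
      refine mul_le_mul_of_nonneg_left ?_ (hw0 x)
      have h3 : ‖2 * Real.pi * q x‖ ≤ 2 * Real.pi * M := by
        rw [Real.norm_of_nonneg (by have := Real.pi_pos; have := hc.le.trans h1; positivity)]
        gcongr
      calc _ ≤ 1 * (2 * Real.pi * M) :=
            mul_le_mul (Real.abs_sin_le_one _) h3 (norm_nonneg _) zero_le_one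
        _ = _ := one_mul _
  have hderiv : ∀ t : ℝ, Integrable
      (fun x => w x * (-Real.sin (2 * Real.pi * (t * q x)) * (2 * Real.pi * q x))) μ ∧
      HasDerivAt (fun t => ∫ x, w x * Real.cos (2 * Real.pi * (t * q x)) ∂μ)
      (∫ x, w x * (-Real.sin (2 * Real.pi * (t * q x)) * (2 * Real.pi * q x)) ∂μ) t := fun t => by
    refine hasDerivAt_integral_of_dominated_loc_of_deriv_le (s := Set.univ)
      (F := fun t x => w x * Real.cos (2 * Real.pi * (t * q x)))
      (F' := fun t x => w x * (-Real.sin (2 * Real.pi * (t * q x)) * (2 * Real.pi * q x)))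
      (bound := fun x => w x * (2 * Real.pi * M)) univ_mem ?_ ?_ ?_ ?_ ?_ ?_
    · exact Eventually.of_forall fun t => hw.aestronglyMeasurable.mul (hmeas t)
    · exact hw.mul_bdd (c := 1) (hmeas t) (ae_of_all _ fun x => Real.abs_cos_le_one _)
    · exact hw.aestronglyMeasurable.mul ((hmeas' t).neg.mul (hq.const_mul _))
    · exact ae_of_all _ fun x t _ => hbound t x
    · exact hw.mul_const _
    · refine ae_of_all _ fun x t _ => ?_
      have h1 : HasDerivAt (fun t : ℝ => 2 * Real.pi * (t * q x)) (2 * Real.pi * q x) t := by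
        simpa using ((hasDerivAt_id t).mul_const (q x)).const_mul (2 * Real.pi)
      exact ((Real.hasDerivAt_cos _).comp t h1).const_mul (w x)
  have hlt : ∀ᶠ t in 𝓝[>] (0 : ℝ), t < 1 / (2 * M) :=
    mem_nhdsWithin_of_mem_nhds (Iio_mem_nhds (by positivity))
  filter_upwards [hlt, self_mem_nhdsWithin] with t ht ht0
  refine ⟨_, ne_of_lt ?_, (hderiv t).2⟩
  rw [← neg_pos, ← integral_neg]
  have hsin : ∀ x, w x ≠ 0 → 0 < Real.sin (2 * Real.pi * (t * q x)) * (2 * Real.pi * q x) :=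
      fun x hx => by
    obtain ⟨h1, h2⟩ := hqw x hx
    have hqpos : 0 < q x := hc.trans_le h1
    have hpi := Real.pi_pos
    have ht0' : 0 < t := ht0
    refine mul_pos (Real.sin_pos_of_pos_of_lt_pi (by positivity) ?_) (by positivity)
    have h3 : t * q x < 1 / 2 := by
      calc t * q x ≤ t * M := by gcongr
        _ < 1 / (2 * M) * M := by gcongr
        _ = 1 / 2 := by field_simp
    nlinarith
  rw [integral_pos_iff_support_of_nonneg]
  · rw [integral_pos_iff_support_of_nonneg hw0 hw] at hpos
    refine hpos.trans_le (measure_mono fun x hx => ?_)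
    have h1 := hsin x hx
    have h2 : 0 < w x := lt_of_le_of_ne (hw0 x) (Ne.symm hx)
    rw [Function.mem_support, neg_mul, mul_neg, neg_neg]
    positivity
  · intro x
    simp only [neg_mul, mul_neg, neg_neg, Pi.zero_apply]
    by_cases hx : w x = 0
    · simp [hx]
    · exact mul_nonneg (hw0 x) (hsin x hx).le
  · exact (hderiv t).1.neg

end Transverse

/-! ### The data of two caps -/

section TwoCaps

open scoped NNReal RealInnerProductSpace FourierTransform

theorem cap_eq_inter_ball {n : ℕ} (S : Set (EuclideanSpace ℝ (Fin n))) (ε : ℝ)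
    (a : EuclideanSpace ℝ (Fin n)) : cap S ε a = S ∩ Metric.ball a ε := by
  ext x; simp [cap, dist_eq_norm]

/-- Small caps around a transverse point are measurable, have finite measure and closure in `S`, and
are graphs over a neighbourhood in `π`, with a section that does not depend on their radius. -/
theorem IsC1Submanifold.exists_cap_isGraphDensity {n k : ℕ} {S : Set (EuclideanSpace ℝ (Fin n))}
    (hS : IsC1Submanifold k S) {π : Submodule ℝ (EuclideanSpace ℝ (Fin n))}
    (hπ : finrank ℝ π = k) {p : EuclideanSpace ℝ (Fin n)} (hp : p ∈ S)
    (hT : tangentSpaceAt S p ⊓ πᗮ = ⊥) :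
    ∃ ε₀ > 0, ∃ s : π → EuclideanSpace ℝ (Fin n), Continuous s ∧ ∀ ε : ℝ, 0 < ε → ε < ε₀ →
      MeasurableSet (cap S ε p) ∧ closure (cap S ε p) ⊆ S ∧
      Measure.euclideanHausdorffMeasure k (cap S ε p) < ∞ ∧
      π.orthogonalProjectionOnto '' (cap S ε p) ∈ 𝓝 (π.orthogonalProjectionOnto p) ∧
      (∀ ξ ∈ cap S ε p, s (π.orthogonalProjectionOnto ξ) = ξ) ∧
      ∃ J : π → ℝ, IsGraphDensity k π (cap S ε p) s J := by
  obtain ⟨V, hV, φ, hpφ⟩ := hS.exists_localParam hp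
  obtain ⟨⟨W, hW, K, s, hs, hsW⟩, himg⟩ :=
    φ.exists_lipschitz_section (by rw [hπ, hV]) hp hpφ hT
  obtain ⟨W', hW', hfin⟩ := φ.exists_hausdorffMeasure_lt_top hp hpφ
  obtain ⟨r, hr, hball⟩ := Metric.nhds_basis_closedBall.mem_iff.1
    (inter_mem (inter_mem hW hW') (φ.isOpen_nhd.mem_nhds hpφ))
  have hKc : IsCompact (S ∩ Metric.closedBall p r) :=
    φ.isCompact_inter _ (fun x hx => (hball hx).2) (isCompact_closedBall p r)
  refine ⟨r, hr, s, hs.continuous, fun ε hε hεr => ?_⟩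
  have hsub : cap S ε p ⊆ S ∩ Metric.closedBall p r := by
    rw [cap_eq_inter_ball]
    exact Set.inter_subset_inter_right S
      ((Metric.ball_subset_ball hεr.le).trans Metric.ball_subset_closedBall)
  have hmeas : MeasurableSet (cap S ε p) := by
    have : cap S ε p = (S ∩ Metric.closedBall p r) ∩ Metric.ball p ε := by
      rw [Set.inter_assoc, Set.inter_eq_right.2
        ((Metric.ball_subset_ball hεr.le).trans Metric.ball_subset_closedBall),
        cap_eq_inter_ball]
    rw [this]
    exact hKc.measurableSet.inter Metric.isOpen_ball.measurableSet
  have hsec : ∀ ξ ∈ cap S ε p, s (π.orthogonalProjectionOnto ξ) = ξ := fun ξ hξ =>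
    hsW ξ ⟨hξ.1, (hball (hsub hξ).2).1.1⟩
  refine ⟨hmeas, (closure_minimal hsub hKc.isClosed).trans Set.inter_subset_left, ?_, ?_, hsec,
    exists_isGraphDensity hπ hmeas (hKc.isBounded.subset hsub) hs hsec⟩
  · rw [← hV]
    exact (measure_mono (t := S ∩ W') fun x hx =>
      ⟨hx.1, (hball (hsub hx).2).1.2⟩).trans_lt hfin
  · rw [cap_eq_inter_ball]
    exact himg _ (Metric.ball_mem_nhds p hε)

theorem norm_sq_add_mul_fourierChar (a b α β : ℝ) :
    ‖(a : ℂ) * (𝐞 (-α) : Circle) + (b : ℂ) * (𝐞 (-β) : Circle)‖ ^ 2 =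
      a ^ 2 + b ^ 2 + 2 * (a * b * Real.cos (2 * Real.pi * (α - β))) := by
  have h : ∀ t : ℝ, ((𝐞 (-t) : Circle) : ℂ) =
      (Real.cos (2 * Real.pi * t) : ℂ) - (Real.sin (2 * Real.pi * t) : ℂ) * Complex.I := fun t => by
    rw [Real.fourierChar_apply, Complex.exp_mul_I]
    push_cast
    rw [mul_neg, Complex.cos_neg, Complex.sin_neg]
    ring
  rw [h, h, Complex.sq_norm, Complex.normSq_apply, mul_sub (2 * Real.pi), Real.cos_sub]
  simp only [Complex.add_re, Complex.mul_re, Complex.sub_re, Complex.ofReal_re, Complex.ofReal_im,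
    Complex.I_re, Complex.I_im, Complex.add_im, Complex.mul_im, Complex.sub_im]
  have h1 := Real.sin_sq_add_cos_sq (2 * Real.pi * α)
  have h2 := Real.sin_sq_add_cos_sq (2 * Real.pi * β)
  linear_combination a ^ 2 * h1 + b ^ 2 * h2

/-- On the plane `π + y`, the Fourier extension of a cap is the Fourier transform on `π` of its
density modulated by `y`. -/
theorem IsGraphDensity.integral_exp_eq_fourier {n k : ℕ}
    {π : Submodule ℝ (EuclideanSpace ℝ (Fin n))}
    {C : Set (EuclideanSpace ℝ (Fin n))} {s : π → EuclideanSpace ℝ (Fin n)} {J : π → ℝ}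
    (hJ : IsGraphDensity k π C s J) (hC : MeasurableSet C) (hs : Continuous s)
    (hsC : ∀ ξ ∈ C, s (π.orthogonalProjectionOnto ξ) = ξ) (x : π)
    (y : EuclideanSpace ℝ (Fin n)) :
    ∫ ξ in C, Complex.exp (-2 * Real.pi * Complex.I * (⟪(x : EuclideanSpace ℝ (Fin n)) + y, ξ⟫ : ℝ))
      ∂(Measure.euclideanHausdorffMeasure k) =
      𝓕 (fun u => (J u : ℂ) * (𝐞 (-⟪y, s u⟫) : Circle)) x := by
  have hcont : Continuous fun u : π =>
      ((𝐞 (-⟪u, x⟫) : Circle) : ℂ) * ((𝐞 (-⟪y, s u⟫) : Circle) : ℂ) := by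
    have := Real.continuous_fourierChar
    fun_prop
  rw [Real.fourier_eq]
  have e1 : ∀ u : π, 𝐞 (-⟪u, x⟫) • ((J u : ℂ) * (𝐞 (-⟪y, s u⟫) : Circle)) =
      J u • (((𝐞 (-⟪u, x⟫) : Circle) : ℂ) * ((𝐞 (-⟪y, s u⟫) : Circle) : ℂ)) := fun u => by
    rw [Circle.smul_def, smul_eq_mul, Complex.real_smul]; ring
  simp only [e1]
  rw [← hJ.setIntegral_comp _ hcont]
  refine setIntegral_congr_fun hC fun ξ hξ => ?_
  rw [hsC ξ hξ, inner_coe_add_eq_inner_projection_add, fourierChar_neg_eq_exp,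
    fourierChar_neg_eq_exp,
    ← Complex.exp_add]
  congr 1
  push_cast
  ring

theorem fourierExtension_twoCaps {n k : ℕ} {S : Set (EuclideanSpace ℝ (Fin n))} {ε : ℝ}
    {ξ₀ η₀ : EuclideanSpace ℝ (Fin n)} (h₁ : MeasurableSet (cap S ε ξ₀))
    (h₂ : MeasurableSet (cap S ε η₀))
    (f₁ : Measure.euclideanHausdorffMeasure k (cap S ε ξ₀) < ∞)
    (f₂ : Measure.euclideanHausdorffMeasure k (cap S ε η₀) < ∞) (x : EuclideanSpace ℝ (Fin n)) :
    fourierExtension k S (twoCaps S ε ξ₀ η₀) x =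
      (∫ ξ in cap S ε ξ₀, Complex.exp (-2 * Real.pi * Complex.I * (⟪x, ξ⟫ : ℝ))
        ∂(Measure.euclideanHausdorffMeasure k)) +
      ∫ ξ in cap S ε η₀, Complex.exp (-2 * Real.pi * Complex.I * (⟪x, ξ⟫ : ℝ))
        ∂(Measure.euclideanHausdorffMeasure k) := by
  set E : EuclideanSpace ℝ (Fin n) → ℂ :=
    fun ξ => Complex.exp (-2 * Real.pi * Complex.I * (⟪x, ξ⟫ : ℝ)) with hE
  have hEn : ∀ ξ, ‖E ξ‖ ≤ 1 := fun ξ => by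
    have h := fourierChar_neg_eq_exp ⟪x, ξ⟫
    rw [hE]; simp only; rw [← h, Circle.norm_coe]
  have hEc : Continuous E := by fun_prop
  have hres : ∀ a, MeasurableSet (cap S ε a) →
      (surfaceMeasure k S).restrict (cap S ε a) =
        (Measure.euclideanHausdorffMeasure k).restrict (cap S ε a) := fun a ha => by
    rw [surfaceMeasure, Measure.restrict_restrict ha, Set.inter_eq_left.2 (fun x hx => hx.1)]
  have hint : ∀ a, MeasurableSet (cap S ε a) →
      Measure.euclideanHausdorffMeasure k (cap S ε a) < ∞ →
      Integrable ((cap S ε a).indicator E) (surfaceMeasure k S) := fun a ha hf => by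
    rw [integrable_indicator_iff ha, IntegrableOn, hres a ha]
    have : IsFiniteMeasure ((Measure.euclideanHausdorffMeasure k).restrict (cap S ε a)) :=
      ⟨by simpa using hf⟩
    exact Integrable.of_bound hEc.aestronglyMeasurable 1 (ae_of_all _ hEn)
  have e : ∀ ξ, twoCaps S ε ξ₀ η₀ ξ * E ξ =
      (cap S ε ξ₀).indicator E ξ + (cap S ε η₀).indicator E ξ := fun ξ => by
    rw [twoCaps, add_mul]
    congr 1 <;> (simp only [Set.indicator]; split_ifs <;> simp)
  rw [fourierExtension]
  rw [integral_congr_ae (ae_of_all _ e), integral_add (hint _ h₁ f₁) (hint _ h₂ f₂),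
    integral_indicator h₁, integral_indicator h₂, hres _ h₁, hres _ h₂]

theorem isCompactDensity_twoCaps {n k : ℕ} {S : Set (EuclideanSpace ℝ (Fin n))} {ε : ℝ}
    {ξ₀ η₀ : EuclideanSpace ℝ (Fin n)} (h₁ : MeasurableSet (cap S ε ξ₀))
    (h₂ : MeasurableSet (cap S ε η₀))
    (f₁ : Measure.euclideanHausdorffMeasure k (cap S ε ξ₀) < ∞)
    (f₂ : Measure.euclideanHausdorffMeasure k (cap S ε η₀) < ∞)
    (c₁ : closure (cap S ε ξ₀) ⊆ S) (c₂ : closure (cap S ε η₀) ⊆ S) :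
    IsCompactDensity k S (twoCaps S ε ξ₀ η₀) := by
  have hσ : ∀ a, MeasurableSet (cap S ε a) →
      Measure.euclideanHausdorffMeasure k (cap S ε a) < ∞ → surfaceMeasure k S (cap S ε a) ≠ ∞ :=
    fun a ha hf => ((Measure.restrict_apply_le _ _).trans_lt hf).ne
  have hmem : ∀ q : ℝ≥0∞, MemLp (twoCaps S ε ξ₀ η₀) q (surfaceMeasure k S) := fun q =>
    (memLp_indicator_const q h₁ (1 : ℂ) (Or.inr (hσ _ h₁ f₁))).add
      (memLp_indicator_const q h₂ (1 : ℂ) (Or.inr (hσ _ h₂ f₂)))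
  have hsub : tsupport (twoCaps S ε ξ₀ η₀) ⊆ closure (cap S ε ξ₀) ∪ closure (cap S ε η₀) := by
    rw [← closure_union]
    refine closure_mono fun ξ hξ => ?_
    by_contra h
    rw [Set.mem_union, not_or] at h
    exact hξ (by simp [twoCaps, h.1, h.2])
  have hcomp : ∀ a, IsCompact (closure (cap S ε a)) := fun a =>
    (Metric.isBounded_ball.subset (by
      rw [cap_eq_inter_ball]; exact Set.inter_subset_right)).isCompact_closure
  exact ⟨hmem 2, memLp_one_iff_integrable.1 (hmem 1),
    ((hcomp ξ₀).union (hcomp η₀)).of_isClosed_subset (isClosed_tsupport _) hsub,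
    hsub.trans (Set.union_subset c₁ c₂)⟩

theorem IsGraphDensity.integrable_mul {n k : ℕ} {π : Submodule ℝ (EuclideanSpace ℝ (Fin n))}
    {C C' : Set (EuclideanSpace ℝ (Fin n))} {s s' : π → EuclideanSpace ℝ (Fin n)} {J J' : π → ℝ}
    (hJ : IsGraphDensity k π C s J) (hJ' : IsGraphDensity k π C' s' J') :
    Integrable fun u => J u * J' u := by
  obtain ⟨M, hM⟩ := hJ'.bounded
  exact hJ.integrable.mul_bdd (c := M) hJ'.measurable.aestronglyMeasurable
    (ae_of_all _ fun u => by rw [Real.norm_of_nonneg (hJ'.nonneg u)]; exact hM u)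

/-- The data of two caps: only the interference term depends on `y`. -/
theorem tomographicData_twoCaps {n k : ℕ} {S : Set (EuclideanSpace ℝ (Fin n))}
    {π : Submodule ℝ (EuclideanSpace ℝ (Fin n))} {ε : ℝ}
    {ξ₀ η₀ : EuclideanSpace ℝ (Fin n)} (h₁ : MeasurableSet (cap S ε ξ₀))
    (h₂ : MeasurableSet (cap S ε η₀))
    (f₁ : Measure.euclideanHausdorffMeasure k (cap S ε ξ₀) < ∞)
    (f₂ : Measure.euclideanHausdorffMeasure k (cap S ε η₀) < ∞)
    {s₁ s₂ : π → EuclideanSpace ℝ (Fin n)} (hs₁ : Continuous s₁) (hs₂ : Continuous s₂)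
    (hsC₁ : ∀ ξ ∈ cap S ε ξ₀, s₁ (π.orthogonalProjectionOnto ξ) = ξ)
    (hsC₂ : ∀ ξ ∈ cap S ε η₀, s₂ (π.orthogonalProjectionOnto ξ) = ξ) {J₁ J₂ : π → ℝ}
    (hJ₁ : IsGraphDensity k π (cap S ε ξ₀) s₁ J₁) (hJ₂ : IsGraphDensity k π (cap S ε η₀) s₂ J₂)
    (y : EuclideanSpace ℝ (Fin n)) :
    tomographicData k S (twoCaps S ε ξ₀ η₀) π y < ∞ ∧
      (tomographicData k S (twoCaps S ε ξ₀ η₀) π y).toReal =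
        (∫ u, (J₁ u * J₁ u + J₂ u * J₂ u)) +
          2 * ∫ u, J₁ u * J₂ u * Real.cos (2 * Real.pi * ⟪y, s₁ u - s₂ u⟫) := by
  have hchar : ∀ {s : π → EuclideanSpace ℝ (Fin n)}, Continuous s →
      Continuous fun u => ((𝐞 (-⟪y, s u⟫) : Circle) : ℂ) := fun hs => by
    have := Real.continuous_fourierChar
    fun_prop
  have hi : ∀ {C : Set (EuclideanSpace ℝ (Fin n))} {s : π → EuclideanSpace ℝ (Fin n)} {J : π → ℝ},
      IsGraphDensity k π C s J → Continuous s →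
      Integrable fun u => (J u : ℂ) * (𝐞 (-⟪y, s u⟫) : Circle) := fun hJ hs =>
    hJ.integrable.ofReal.mul_bdd (c := 1) (hchar hs).aestronglyMeasurable
      (ae_of_all _ fun u => (Circle.norm_coe _).le)
  set F : π → ℂ := fun u =>
    (J₁ u : ℂ) * (𝐞 (-⟪y, s₁ u⟫) : Circle) + (J₂ u : ℂ) * (𝐞 (-⟪y, s₂ u⟫) : Circle) with hF
  have hF1 : Integrable F := (hi hJ₁ hs₁).add (hi hJ₂ hs₂)
  have hsum : Integrable fun u => J₁ u * J₁ u + J₂ u * J₂ u :=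
    (hJ₁.integrable_mul hJ₁).add (hJ₂.integrable_mul hJ₂)
  have hcos : Integrable fun u =>
      2 * (J₁ u * J₂ u * Real.cos (2 * Real.pi * ⟪y, s₁ u - s₂ u⟫)) := by
    have hc : Continuous fun u => Real.cos (2 * Real.pi * ⟪y, s₁ u - s₂ u⟫) := by fun_prop
    exact ((hJ₁.integrable_mul hJ₂).mul_bdd (c := 1) hc.aestronglyMeasurable
      (ae_of_all _ fun u => Real.abs_cos_le_one _)).const_mul 2
  have hFsq : ∀ u, ‖F u‖ ^ 2 = (J₁ u * J₁ u + J₂ u * J₂ u) +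
      2 * (J₁ u * J₂ u * Real.cos (2 * Real.pi * ⟪y, s₁ u - s₂ u⟫)) := fun u => by
    rw [hF]
    simp only
    rw [norm_sq_add_mul_fourierChar, inner_sub_right]
    ring
  have hFsqi : Integrable fun u => ‖F u‖ ^ 2 := by
    simp only [hFsq]
    exact hsum.add hcos
  have hF2 : MemLp F 2 := (memLp_two_iff_integrable_sq_norm hF1.aestronglyMeasurable).2 hFsqi
  have hfour : ∀ x : π, fourierExtension k S (twoCaps S ε ξ₀ η₀) (x + y) = 𝓕 F x := fun x => by
    rw [fourierExtension_twoCaps h₁ h₂ f₁ f₂, hJ₁.integral_exp_eq_fourier h₁ hs₁ hsC₁,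
      hJ₂.integral_exp_eq_fourier h₂ hs₂ hsC₂]
    exact (fourier_fun_add (hi hJ₁ hs₁) (hi hJ₂ hs₂) x).symm
  rw [tomographicData, planeTransform]
  simp only [hfour]
  rw [lintegral_norm_sq_fourier hF1 hF2, ← ofReal_integral_eq_lintegral_ofReal hFsqi
    (ae_of_all _ fun u => by positivity)]
  refine ⟨ENNReal.ofReal_lt_top, ?_⟩
  rw [ENNReal.toReal_ofReal (integral_nonneg fun u => by positivity)]
  simp only [hFsq]
  rw [integral_add hsum hcos, integral_const_mul]

end TwoCaps

/-! ### Necessity of the transversality conditions -/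

section Main

open scoped NNReal RealInnerProductSpace FourierTransform

theorem exists_sub_mem_orthogonal_of_not_globally {n : ℕ}
    {S : Set (EuclideanSpace ℝ (Fin n))} {π : Submodule ℝ (EuclideanSpace ℝ (Fin n))}
    (h : ¬ GloballyTransverse S π) : ∃ ξ₀ ∈ S, ∃ η₀ ∈ S, ξ₀ - η₀ ∈ πᗮ ∧ ξ₀ - η₀ ≠ 0 := by
  simp only [GloballyTransverse, not_forall] at h
  obtain ⟨ξ, hξ, η, hη, hne⟩ := h
  obtain ⟨v, ⟨hv, hvπ⟩, hv0⟩ := (Submodule.ne_bot_iff _).1 hne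
  obtain ⟨c, rfl⟩ := Submodule.mem_span_singleton.1 hv
  have hc : c ≠ 0 := fun hc => hv0 (by rw [hc, zero_smul])
  exact ⟨ξ, hξ, η, hη, (Submodule.smul_mem_iff _ hc).1 hvπ, fun h0 => hv0 (by rw [h0, smul_zero])⟩

/-- If `S` is transverse to `πᗮ` and `ξ₀ - η₀` lies in `πᗮ`, the data of two small caps around `ξ₀`
and `η₀` have a nonzero derivative in the direction `ξ₀ - η₀`. -/
theorem exists_twoCaps_hasLineDerivAt {n k : ℕ} {S : Set (EuclideanSpace ℝ (Fin n))}
    (hS : IsC1Submanifold k S) {π : Submodule ℝ (EuclideanSpace ℝ (Fin n))}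
    (hπ : finrank ℝ π = k) (hT : LocallyTransverse S π) {ξ₀ η₀ : EuclideanSpace ℝ (Fin n)}
    (hξ : ξ₀ ∈ S) (hη : η₀ ∈ S) (hperp : ξ₀ - η₀ ∈ πᗮ) (hne : ξ₀ - η₀ ≠ 0) :
    ∃ ε₀ > 0, ∀ ε : ℝ, 0 < ε → ε < ε₀ →
      IsCompactDensity k S (twoCaps S ε ξ₀ η₀) ∧
      (∀ y, tomographicData k S (twoCaps S ε ξ₀ η₀) π y < ∞) ∧
      ∀ᶠ t : ℝ in 𝓝[>] 0, ∃ D : ℝ, D ≠ 0 ∧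
        HasLineDerivAt ℝ (fun y => (tomographicData k S (twoCaps S ε ξ₀ η₀) π y).toReal)
          D (t • (ξ₀ - η₀)) (ξ₀ - η₀) := by
  obtain ⟨ε₁, hε₁, s₁, hs₁, H₁⟩ := hS.exists_cap_isGraphDensity hπ hξ (hT ξ₀ hξ)
  obtain ⟨ε₂, hε₂, s₂, hs₂, H₂⟩ := hS.exists_cap_isGraphDensity hπ hη (hT η₀ hη)
  set v := ξ₀ - η₀ with hv
  have hvpos : 0 < ‖v‖ := norm_pos_iff.2 hne
  -- `ε < ‖v‖ / 4` keeps `s₁ - s₂` within `‖v‖ / 2` of `v` on the common support of the densities.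
  refine ⟨min (min ε₁ ε₂) (‖v‖ / 4), by positivity, fun ε hε hεlt => ?_⟩
  have hεv : ε < ‖v‖ / 4 := hεlt.trans_le (min_le_right _ _)
  obtain ⟨h₁, c₁, f₁, n₁, hsC₁, J₁, hJ₁⟩ := H₁ ε hε
    (hεlt.trans_le ((min_le_left _ _).trans (min_le_left _ _)))
  obtain ⟨h₂, c₂, f₂, n₂, hsC₂, J₂, hJ₂⟩ := H₂ ε hε
    (hεlt.trans_le ((min_le_left _ _).trans (min_le_right _ _)))
  have hdata := tomographicData_twoCaps h₁ h₂ f₁ f₂ hs₁ hs₂ hsC₁ hsC₂ hJ₁ hJ₂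
  refine ⟨isCompactDensity_twoCaps h₁ h₂ f₁ f₂ c₁ c₂,
    fun y => (hdata y).1, ?_⟩
  set A : ℝ := ∫ u, (J₁ u * J₁ u + J₂ u * J₂ u)
  have hJJ0 : ∀ u, 0 ≤ J₁ u * J₂ u := fun u => mul_nonneg (hJ₁.nonneg u) (hJ₂.nonneg u)
  have hJJi := hJ₁.integrable_mul hJ₂
  have hq : ∀ u, J₁ u * J₂ u ≠ 0 →
      ‖v‖ ^ 2 / 2 ≤ ⟪v, s₁ u - s₂ u⟫ ∧ ⟪v, s₁ u - s₂ u⟫ ≤ 3 / 2 * ‖v‖ ^ 2 := fun u hu => by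
    have m₁ : ‖s₁ u - ξ₀‖ < ε := (hJ₁.section_mem u (left_ne_zero_of_mul hu)).2
    have m₂ : ‖s₂ u - η₀‖ < ε := (hJ₂.section_mem u (right_ne_zero_of_mul hu)).2
    have e : ⟪v, s₁ u - s₂ u⟫ = ‖v‖ ^ 2 + ⟪v, (s₁ u - ξ₀) - (s₂ u - η₀)⟫ := by
      rw [← real_inner_self_eq_norm_sq, ← inner_add_right]
      congr 1
      rw [hv]; abel
    have hb : |⟪v, (s₁ u - ξ₀) - (s₂ u - η₀)⟫| ≤ ‖v‖ * (‖v‖ / 2) := by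
      refine (abs_real_inner_le_norm _ _).trans ?_
      gcongr
      exact (norm_sub_le _ _).trans (by linarith)
    have := abs_le.1 hb
    rw [e]
    constructor <;> nlinarith
  have hpos : 0 < ∫ u, J₁ u * J₂ u := by
    rw [integral_pos_iff_support_of_nonneg hJJ0 hJJi]
    have hP : π.orthogonalProjectionOnto ξ₀ = π.orthogonalProjectionOnto η₀ := by
      rw [← sub_eq_zero, ← map_sub]
      exact Submodule.orthogonalProjectionOnto_eq_zero_iff.2 hperp
    rw [← hP] at n₂
    refine (Measure.measure_pos_of_mem_nhds volume (inter_mem n₁ n₂)).trans_le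
      (measure_mono_ae ?_)
    filter_upwards [hJ₁.pos, hJ₂.pos] with u p₁ p₂ hu
    exact (mul_pos (p₁ hu.1) (p₂ hu.2)).ne'
  have hqc : Continuous fun u => ⟪v, s₁ u - s₂ u⟫ := by fun_prop
  filter_upwards [eventually_exists_hasDerivAt_integral_cos hJJi hqc.aestronglyMeasurable hJJ0
    (by positivity : 0 < ‖v‖ ^ 2 / 2) hq hpos] with t ht
  obtain ⟨D, hD0, hD⟩ := ht
  refine ⟨2 * D, by simpa using hD0, ?_⟩
  have h3 : ∀ r : ℝ, (tomographicData k S (twoCaps S ε ξ₀ η₀) π (t • v + r • v)).toReal =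
      A + 2 * ∫ u, J₁ u * J₂ u * Real.cos (2 * Real.pi * ((t + r) * ⟪v, s₁ u - s₂ u⟫)) :=
    fun r => by rw [(hdata _).2, ← add_smul]; simp only [real_inner_smul_left]
  rw [HasLineDerivAt]
  simp only [h3]
  have h4 := HasDerivAt.comp_const_add t 0 (by simpa using (hD.const_mul 2).const_add A)
  simpa using h4

end Main

theorem mainTheorem5 (n k : ℕ) (S : Set (EuclideanSpace ℝ (Fin n))) (hS : IsC1Submanifold k S)
    (π : Submodule ℝ (EuclideanSpace ℝ (Fin n))) (hπ : finrank ℝ π = k) :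
    -- Necessity of (GT): the data of two small caps depends on `y`, and the identity fails.
    (LocallyTransverse S π →
      (¬ GloballyTransverse S π → ∃ ξ₀ ∈ S, ∃ η₀ ∈ S, ξ₀ - η₀ ∈ πᗮ ∧ ξ₀ - η₀ ≠ 0) ∧
      ∀ ξ₀ ∈ S, ∀ η₀ ∈ S, ξ₀ - η₀ ∈ πᗮ → ξ₀ - η₀ ≠ 0 →
        ∃ ε₀ > 0, ∀ ε : ℝ, 0 < ε → ε < ε₀ →
          IsCompactDensity k S (twoCaps S ε ξ₀ η₀) ∧
          (∀ y ∈ πᗮ, tomographicData k S (twoCaps S ε ξ₀ η₀) π y < ∞) ∧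
          (∀ᶠ t : ℝ in 𝓝[>] 0, ∃ D : ℝ, D ≠ 0 ∧
            HasLineDerivAt ℝ (fun y => (tomographicData k S (twoCaps S ε ξ₀ η₀) π y).toReal)
              D (t • (ξ₀ - η₀)) (ξ₀ - η₀)) ∧
          (∃ y ∈ πᗮ, ∃ y' ∈ πᗮ, tomographicData k S (twoCaps S ε ξ₀ η₀) π y ≠
            tomographicData k S (twoCaps S ε ξ₀ η₀) π y') ∧
          (∃ y ∈ πᗮ, tomographicData k S (twoCaps S ε ξ₀ η₀) π y ≠
            geometricEnergy k S (twoCaps S ε ξ₀ η₀) π)) ∧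
    -- Necessity of (T) for finiteness.
    (¬ LocallyTransverse S π →
      ∀ y ∈ πᗮ, ∃ g : EuclideanSpace ℝ (Fin n) → ℂ, IsCompactDensity k S g ∧
        tomographicData k S g π y = ∞ ∧ geometricEnergy k S g π = ∞) ∧
    -- Hence both conditions are necessary for the identity, with finite values.
    ((∀ g : EuclideanSpace ℝ (Fin n) → ℂ, IsCompactDensity k S g → ∀ y ∈ πᗮ,
        tomographicData k S g π y = geometricEnergy k S g π ∧
        tomographicData k S g π y < ∞) →
      LocallyTransverse S π ∧ GloballyTransverse S π) := by
  have h1 : LocallyTransverse S π →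
      ∀ ξ₀ ∈ S, ∀ η₀ ∈ S, ξ₀ - η₀ ∈ πᗮ → ξ₀ - η₀ ≠ 0 →
        ∃ ε₀ > 0, ∀ ε : ℝ, 0 < ε → ε < ε₀ →
          IsCompactDensity k S (twoCaps S ε ξ₀ η₀) ∧
          (∀ y ∈ πᗮ, tomographicData k S (twoCaps S ε ξ₀ η₀) π y < ∞) ∧
          (∀ᶠ t : ℝ in 𝓝[>] 0, ∃ D : ℝ, D ≠ 0 ∧
            HasLineDerivAt ℝ (fun y => (tomographicData k S (twoCaps S ε ξ₀ η₀) π y).toReal)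
              D (t • (ξ₀ - η₀)) (ξ₀ - η₀)) ∧
          (∃ y ∈ πᗮ, ∃ y' ∈ πᗮ, tomographicData k S (twoCaps S ε ξ₀ η₀) π y ≠
            tomographicData k S (twoCaps S ε ξ₀ η₀) π y') ∧
          (∃ y ∈ πᗮ, tomographicData k S (twoCaps S ε ξ₀ η₀) π y ≠
            geometricEnergy k S (twoCaps S ε ξ₀ η₀) π) := by
    intro hT ξ₀ hξ η₀ hη hperp hne
    obtain ⟨ε₀, hε₀, H⟩ := exists_twoCaps_hasLineDerivAt hS hπ hT hξ hη hperp hne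
    refine ⟨ε₀, hε₀, fun ε hε hεlt => ?_⟩
    obtain ⟨hg, hfin, hder⟩ := H ε hε hεlt
    have hnc : ∃ y ∈ πᗮ, ∃ y' ∈ πᗮ, tomographicData k S (twoCaps S ε ξ₀ η₀) π y ≠
        tomographicData k S (twoCaps S ε ξ₀ η₀) π y' := by
      -- If the data were constant on `πᗮ`, the nonzero derivative would vanish.
      by_contra! hconst
      obtain ⟨t, D, hD0, hD⟩ := hder.exists
      refine hD0 (HasDerivAt.unique hD ?_)
      refine (hasDerivAt_const (0 : ℝ)
        (tomographicData k S (twoCaps S ε ξ₀ η₀) π 0).toReal).congr_of_eventuallyEq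
        (Eventually.of_forall fun r => ?_)
      simp only
      rw [hconst _ (πᗮ.add_mem (πᗮ.smul_mem t hperp) (πᗮ.smul_mem r hperp)) 0 πᗮ.zero_mem]
    refine ⟨hg, fun y _ => hfin y, hder, hnc, ?_⟩
    obtain ⟨y, hy, y', hy', hyy⟩ := hnc
    by_contra! hid
    exact hyy ((hid y hy).trans (hid y' hy').symm)
  have h2 : ¬ LocallyTransverse S π →
      ∀ y ∈ πᗮ, ∃ g : EuclideanSpace ℝ (Fin n) → ℂ, IsCompactDensity k S g ∧
        tomographicData k S g π y = ∞ ∧ geometricEnergy k S g π = ∞ := by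
    intro hT y _
    simp only [LocallyTransverse, not_forall] at hT
    obtain ⟨p, hp, hne⟩ := hT
    exact exists_isCompactDensity_eq_top hS hπ hp hne y
  refine ⟨fun hT => ⟨exists_sub_mem_orthogonal_of_not_globally, h1 hT⟩, h2, fun hid => ?_⟩
  have hT : LocallyTransverse S π := by
    by_contra hT
    obtain ⟨g, hg, htop, -⟩ := h2 hT 0 πᗮ.zero_mem
    exact (hid g hg 0 πᗮ.zero_mem).2.ne htop
  refine ⟨hT, ?_⟩
  by_contra hG
  obtain ⟨ξ₀, hξ, η₀, hη, hperp, hne⟩ := exists_sub_mem_orthogonal_of_not_globally hG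
  obtain ⟨ε₀, hε₀, H⟩ := h1 hT ξ₀ hξ η₀ hη hperp hne
  obtain ⟨hg, -, -, -, y, hy, hne'⟩ := H (ε₀ / 2) (by positivity) (by linarith)
  exact hne' (hid _ hg y hy).1
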